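/- Let $\mathbb{T}^2=\mathbb{R}^2/\mathbb{Z}^2$ be the 2-torus with its standard orientation. For $m\ge 3$, a framed immersed torus in $\mathbb{R}^m$ is a pair $(\vec\Phi,\vec e)$, where $\vec\Phi:\mathbb{T}^2\to\mathbb{R}^m$ is a smooth immersion and $\vec e=(\vec e_1,\vec e_2)$ is a moving frame on it, i.e. $\vec e_1,\vec e_2:\mathbb{T}^2\to\mathbb{R}^m$ are smooth and for every $x$ the pair $(\vec e_1(x),\vec e_2(x))$ is a positively oriented orthonormal basis of the tangent plane $d\vec\Phi_x(T_x\mathbb{T}^2)$. Let $g=\vec\Phi^*g_{\mathbb{R}^m}$ be the induced metric, $g_{ij}=\partial_{x_i}\vec\Phi\cdot\partial_{x_j}\vec\Phi$. The frame energy is $$\mathcal{F}(\vec\Phi,\vec e)=\frac14\int_{\mathbb{T}^2}|d\vec e|^2\,dvol_g,\qquad |d\vec e|^2=\sum_{i,j,k=1}^2 g^{ij}\,\partial_{x_i}\vec e_k\cdot\partial_{x_j}\vec e_k .$$ Let $\mathcal{M}=\mathbb{H}/SL(2,\mathbb{Z})$, with the quotient topology, be the moduli space of conformal structures on the torus, where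 $\mathbb{H}$ is the upper half plane and $[\tau]\in\mathcal M$ stands for the flat torus $\mathbb{C}/(\mathbb{Z}+\tau\mathbb{Z})$. The conformal class in $\mathcal M$ of a Riemannian metric $g$ on $\mathbb{T}^2$ is the point $[\tau]$ for which there is an orientation preserving conformal diffeomorphism from $\mathbb{C}/(\mathbb{Z}+\tau\mathbb{Z})$ onto $(\mathbb{T}^2,g)$. Then for every $C>0$ there is a compact set $K\subset\mathcal{M}$ (depending only on $C$) such that, for every $m\ge 3$ and every framed immersed torus $(\vec\Phi,\vec e)$ in $\mathbb{R}^m$ with $\mathcal{F}(\vec\Phi,\vec e)\le C$, the induced metric $\vec\Phi^*g_{\mathbb{R}^m}$ has a conformal class in $\mathcal M$, and this class lies in $K$. -/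

import Mathlib

open scoped ContDiff MatrixGroups UpperHalfPlane

noncomputable section

namespace FrameEnergy

/-- The coordinate plane `ℝ²`, universal cover of the abstract torus `𝕋² = ℝ² / ℤ²`, with its
standard orientation. (The norm of this type plays no role: metrics are given explicitly.) -/
abbrev Plane : Type := Fin 2 → ℝ

/-- The Euclidean space `ℝᵐ`. -/
abbrev E (m : ℕ) : Type := EuclideanSpace ℝ (Fin m)

/-- Two points of the plane represent the same point of `𝕋² = ℝ² / ℤ²`. -/
def SameTorusPoint (x y : Plane) : Prop := ∀ i, ∃ k : ℤ, x i - y i = k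

/-- A smooth map `𝕋² → ℝᵐ`, given by its lift to `ℝ²`: a smooth `ℤ²`-periodic map. -/
structure IsSmoothTorusMap {m : ℕ} (f : Plane → E m) : Prop where
  smooth : ContDiff ℝ ∞ f
  periodic : ∀ x y, SameTorusPoint x y → f x = f y

/-- The partial derivative `∂_{x_i} f`. -/
def pd {m : ℕ} (i : Fin 2) (f : Plane → E m) (x : Plane) : E m :=
  fderiv ℝ f x (Pi.single i 1)

/-- A smooth immersion `Φ : 𝕋² → ℝᵐ`. -/
structure IsTorusImmersion {m : ℕ} (Φ : Plane → E m) : Prop extends IsSmoothTorusMap Φ where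
  injective_fderiv : ∀ x, Function.Injective (fderiv ℝ Φ x)

/-- The induced metric `g = Φ^* g_{ℝᵐ}`, `g_{ij} = ∂_{x_i} Φ · ∂_{x_j} Φ`. -/
def inducedMetric {m : ℕ} (Φ : Plane → E m) (x : Plane) : Matrix (Fin 2) (Fin 2) ℝ :=
  Matrix.of fun i j => inner ℝ (pd i Φ x) (pd j Φ x)

/-- `e = (e₁, e₂)` (indexed by `0, 1`) is a moving frame on `Φ`: smooth sections of the tangent
bundle of `Φ` which at each point form a positive orthonormal basis of the tangent plane
`dΦ_x(ℝ²)`, this plane being oriented by `(∂_{x_1} Φ, ∂_{x_2} Φ)`.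
(The two bases have the same orientation iff the matrix `∂_{x_i} Φ · e_j`, which expresses the
coordinate basis in the basis `e`, has positive determinant.) -/
structure IsMovingFrame {m : ℕ} (Φ : Plane → E m) (e : Fin 2 → Plane → E m) : Prop where
  smooth : ∀ k, IsSmoothTorusMap (e k)
  tangent : ∀ k x, e k x ∈ LinearMap.range (fderiv ℝ Φ x).toLinearMap
  orthonormal : ∀ x, Orthonormal ℝ fun k => e k x
  positive : ∀ x, 0 < (Matrix.of fun i j : Fin 2 => (inner ℝ (pd i Φ x) (e j x) : ℝ)).det

/-- `|de|² = ∑_{i,j,k} g^{ij} ∂_{x_i} e_k · ∂_{x_j} e_k`, where `g` is the metric induced by `Φ`. -/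
def frameDensity {m : ℕ} (Φ : Plane → E m) (e : Fin 2 → Plane → E m) (x : Plane) : ℝ :=
  ∑ k, ∑ i, ∑ j, (inducedMetric Φ x)⁻¹ i j * inner ℝ (pd i (e k) x) (pd j (e k) x)

/-- The frame energy `𝓕(Φ, e) = (1/4) ∫_{𝕋²} |de|² dvol_g`, with `dvol_g = √(det g) dx₁ dx₂`; the
integral is over the fundamental domain `[0,1]²` of `𝕋² = ℝ² / ℤ²`. -/
def frameEnergy {m : ℕ} (Φ : Plane → E m) (e : Fin 2 → Plane → E m) : ℝ :=
  1 / 4 * ∫ x in Set.Icc (0 : Plane) 1,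
    frameDensity Φ e x * Real.sqrt (inducedMetric Φ x).det

/-- The moduli space of (oriented) conformal structures on the torus, `ℍ / SL(2, ℤ)`: the class
of `τ` stands for the flat torus `ℂ / (ℤ + τ ℤ)`. -/
abbrev ModuliSpace : Type := MulAction.orbitRel.Quotient SL(2, ℤ) ℍ

/-- The moduli space carries the quotient topology of the upper half plane. -/
instance : TopologicalSpace ModuliSpace :=
  inferInstanceAs (TopologicalSpace (Quotient (MulAction.orbitRel SL(2, ℤ) ℍ)))

/-- The class of `τ` in the moduli space. -/
def moduliMk (τ : ℍ) : ModuliSpace := Quotient.mk (MulAction.orbitRel SL(2, ℤ) ℍ) τ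

/-- `z` and `w` represent the same point of the flat torus `ℂ / (ℤ + τ ℤ)`. -/
def SameFlatPoint (τ : ℍ) (z w : ℂ) : Prop := ∃ a b : ℤ, z - w = a + b * (τ : ℂ)

/-- `Ψ : ℂ → ℝ²` is the lift of an orientation preserving conformal diffeomorphism from the flat
torus `ℂ / (ℤ + τ ℤ)` onto `(𝕋², g)`, where `g` is a Riemannian metric on `𝕋²`: it is smooth,
descends to a bijection of the tori, preserves orientation, and `Ψ^* g` is a positive multiple
of the flat metric. -/
structure IsConformalDiffeo (τ : ℍ) (g : Plane → Matrix (Fin 2) (Fin 2) ℝ) (Ψ : ℂ → Plane) :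
    Prop where
  smooth : ContDiff ℝ ∞ Ψ
  descends : ∀ z w, SameFlatPoint τ z w ↔ SameTorusPoint (Ψ z) (Ψ w)
  surjective : Function.Surjective Ψ
  conformal : ∀ z, ∃ ρ : ℝ, 0 < ρ ∧ ∀ v w : ℂ,
    fderiv ℝ Ψ z v ⬝ᵥ (g (Ψ z)).mulVec (fderiv ℝ Ψ z w) = ρ * inner ℝ v w
  orientation : ∀ z, 0 < (Matrix.of ![fderiv ℝ Ψ z 1, fderiv ℝ Ψ z Complex.I]).det

/-- `p` is the conformal class of the metric `g` on `𝕋²`, as a point of the moduli space: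
`(𝕋², g)` is conformally diffeomorphic to a flat torus in the class `p`. -/
def IsConformalClass (g : Plane → Matrix (Fin 2) (Fin 2) ℝ) (p : ModuliSpace) : Prop :=
  ∃ τ : ℍ, moduliMk τ = p ∧ ∃ Ψ : ℂ → Plane, IsConformalDiffeo τ g Ψ

end FrameEnergy

end

noncomputable section

open MeasureTheory Set UnitAddTorus ComplexConjugate

namespace FrameEnergy

/-! The bound. Suppose `(𝕋², g)` is conformal to `ℂ / (ℤ + τℤ)`, and let `φ` be the immersion in the
flat coordinate `z = x + iy`. In dimension two the Dirichlet integral is conformally invariant, so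
in lattice coordinates on the unit square the frame energy is `(1/4) Im τ` times the integral of `∑
|∇e_k|²` (`frameEnergy_eq`). It therefore suffices to bound that integral below by 1
(`one_le_integral_flatDensity`). Compare `e` with the coordinate frame `t = φ_x/|φ_x|`, `n =
φ_y/|φ_y|`, from which it differs by a rotation of angle `θ`. Then `|de|² = |dt|² + |dn|² + 4 ⟨dt·n,
dθ⟩ + 2|dθ|²`. If `λ` is the logarithm of the conformal factor, `dt·n = -λ_y dx + λ_x dy`, so the
cross term is the exact form `d(λ dθ)` and integrates to zero (`integral_cross_term`). What remains
is at least the integral of `|∂_x t|²`. Each horizontal line of length 1 closes up in the torus, and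
`t` is the unit tangent of the closed curve that it traces. Such a tangent cannot stay in an open
half-space, which costs energy at least 1 (`one_le_integral_of_closed`); this crude form of
Fenchel's theorem is enough. Hence `Im τ ≤ 4𝓕` for every admissible `τ`. Choosing `τ` in the
standard fundamental domain puts it in the part below height `4C`, which is compact.

Existence of the class. The metric is a multiple of `|dz + μ dz̄|²` with `|μ| < 1`. A coordinate `F`
is sought with `dF = e^σ (dz + μ dz̄)`. Closedness reads `∂̄σ = μ ∂σ + ∂μ`, that is `w = μ B w + ∂μ`
for `w = ∂̄σ` and `B = ∂ ∂̄⁻¹`. As `B` is an `ℓ²` isometry on Fourier coefficients, the Neumann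
series converges, with all derivatives (`exists_rapid_solution`). The zero mode of `B` is chosen so
that `σ` is periodic up to imaginary constants; deck transformations then act through `F` by
Euclidean motions. Compactness makes `F` a covering of `ℂ`, hence a bijection
(`bijective_of_equivariant`). A motion with a fixed point would contradict injectivity, so the
motions are translations, and their periods yield `τ` (`exists_conformalDiffeo_of_developing`). -/

/-! ### Periodic functions on the plane -/

/-- A function on the plane that descends to the torus `ℝ² / ℤ²`. -/
def TorusPeriodic {F : Type*} (f : Plane → F) : Prop := ∀ x y, SameTorusPoint x y → f x = f y

lemma sameTorusPoint_add_int (x : Plane) (k : Fin 2 → ℤ) :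
    SameTorusPoint (x + fun i => (k i : ℝ)) x := fun i => ⟨k i, by simp⟩

lemma sameTorusPoint_iff {x y : Plane} :
    SameTorusPoint x y ↔ ∃ k : Fin 2 → ℤ, x = y + fun i => (k i : ℝ) := by
  constructor
  · intro h
    choose k hk using h
    exact ⟨k, funext fun i => by simp [← hk i]⟩
  · rintro ⟨k, rfl⟩
    exact sameTorusPoint_add_int y k

lemma SameTorusPoint.symm {x y : Plane} (h : SameTorusPoint x y) : SameTorusPoint y x := fun i => by
  obtain ⟨k, hk⟩ := h i
  exact ⟨-k, by push_cast; linarith⟩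

lemma SameTorusPoint.trans {x y z : Plane} (h : SameTorusPoint x y) (h' : SameTorusPoint y z) :
    SameTorusPoint x z := fun i => by
  obtain ⟨k, hk⟩ := h i
  obtain ⟨l, hl⟩ := h' i
  exact ⟨k + l, by push_cast; linarith⟩

lemma TorusPeriodic.fderiv {F : Type*} [NormedAddCommGroup F] [NormedSpace ℝ F] {f : Plane → F}
    (h : TorusPeriodic f) : TorusPeriodic (fderiv ℝ f) := by
  intro x y hxy
  obtain ⟨k, rfl⟩ := sameTorusPoint_iff.1 hxy
  have : f = fun z => f (z + fun i => (k i : ℝ)) :=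
    funext fun z => (h _ _ (sameTorusPoint_add_int z k)).symm
  conv_rhs => rw [this]
  rw [fderiv_comp_add_right]

lemma TorusPeriodic.comp {F G : Type*} {f : Plane → F} (h : TorusPeriodic f) (g : F → G) :
    TorusPeriodic fun x => g (f x) := fun x y hxy => by
  simp only [h x y hxy]

lemma TorusPeriodic.comp₂ {F G H : Type*} {f : Plane → F} {f' : Plane → G} (h : TorusPeriodic f)
    (h' : TorusPeriodic f') (g : F → G → H) : TorusPeriodic fun x => g (f x) (f' x) :=
  fun x y hxy => by simp only [h x y hxy, h' x y hxy]

lemma exists_sameTorusPoint_mem_Icc (x : Plane) :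
    ∃ y ∈ Icc (0 : Plane) 1, SameTorusPoint x y := by
  refine ⟨fun i => Int.fract (x i), ⟨fun i => Int.fract_nonneg _, fun i => (Int.fract_lt_one _).le⟩,
    fun i => ⟨⌊x i⌋, ?_⟩⟩
  simp [Int.self_sub_fract]

lemma TorusPeriodic.exists_bound {f : Plane → ℝ} (h : TorusPeriodic f) (hf : Continuous f) :
    ∃ x₀, ∀ x, f x ≤ f x₀ := by
  obtain ⟨x₀, -, h0⟩ := (isCompact_Icc (a := (0 : Plane)) (b := 1)).exists_isMaxOn
    ⟨0, by simp⟩ hf.continuousOn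
  refine ⟨x₀, fun x => ?_⟩
  obtain ⟨y, hy, hxy⟩ := exists_sameTorusPoint_mem_Icc x
  rw [h x y hxy]
  exact h0 hy

/-- Divergence theorem for the field whose only component is `f` in direction `i`: opposite faces of
the square differ by a lattice vector, so their contributions cancel. -/
lemma integral_fderiv_single_eq_zero {F : Type*} [NormedAddCommGroup F] [NormedSpace ℝ F]
    [CompleteSpace F] {f : Plane → F} (hf : ContDiff ℝ 1 f) (h : TorusPeriodic f) (i : Fin 2) :
    ∫ x in Icc (0 : Plane) 1, fderiv ℝ f x (Pi.single i 1) = 0 := by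
  have hc : Continuous fun x => fderiv ℝ f x (Pi.single i 1) :=
    (hf.continuous_fderiv one_ne_zero).clm_apply continuous_const
  have key := integral_divergence_of_hasFDerivAt_off_countable' (0 : Fin 2 → ℝ) 1
    (fun _ => zero_le_one) (fun j x => if j = i then f x else 0)
    (fun j x => if j = i then fderiv ℝ f x else 0) ∅ countable_empty
    (fun j => by
      by_cases hj : j = i
      · simpa [hj] using hf.continuous.continuousOn
      · simpa [hj] using continuousOn_const)
    (fun x _ j => by
      by_cases hj : j = i
      · simpa [hj] using (hf.differentiable one_ne_zero x).hasFDerivAt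
      · simpa [hj] using hasFDerivAt_const (0 : F) x)
    (by
      refine (Continuous.integrableOn_Icc ?_)
      refine continuous_finsetSum _ fun j _ => ?_
      by_cases hj : j = i
      · subst hj; simpa using hc
      · simpa [hj] using continuous_const)
  have e1 : ∀ x : Fin 2 → ℝ, (∑ j : Fin 2, (if j = i then fderiv ℝ f x else 0) (Pi.single j 1))
      = fderiv ℝ f x (Pi.single i 1) := by
    intro x
    rw [Finset.sum_eq_single i (fun j _ hj => by simp [hj]) (by simp)]
    simp
  simp only [e1] at key
  rw [key]
  refine Finset.sum_eq_zero fun j _ => ?_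
  rw [sub_eq_zero]
  refine integral_congr_ae (Filter.Eventually.of_forall fun y => ?_)
  by_cases hj : j = i
  · simp only [hj, if_true]
    refine h _ _ fun l => ?_
    refine Fin.succAboveCases i ?_ (fun l => ?_) l
    · exact ⟨1, by simp⟩
    · exact ⟨0, by simp⟩
  · simp [hj]

/-! ### Fourier series of periodic functions -/

/-- The character `x ↦ exp (2πi k·x)`. -/
def chr (k : Fin 2 → ℤ) (x : Plane) : ℂ :=
  Complex.exp (2 * Real.pi * Complex.I * (k 0 * x 0 + k 1 * x 1))

/-- Fourier coefficients of a periodic function on the plane. -/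
def coef (f : Plane → ℂ) (k : Fin 2 → ℤ) : ℂ := ∫ x in Icc (0 : Plane) 1, chr (-k) x * f x

/-- The function with given Fourier coefficients. -/
def synth (a : (Fin 2 → ℤ) → ℂ) (x : Plane) : ℂ := ∑' k, a k * chr k x

section Bridge

-- Haar measure of total mass 1, for which the characters are orthonormal.
local instance unitCircleMeasureSpace : MeasureSpace UnitAddCircle := ⟨AddCircle.haarAddCircle⟩

local instance : IsProbabilityMeasure (volume : Measure UnitAddCircle) :=
  inferInstanceAs (IsProbabilityMeasure AddCircle.haarAddCircle)

lemma mFourier_coe (k : Fin 2 → ℤ) (x : Plane) :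
    mFourier k (fun i => (x i : UnitAddCircle)) = chr k x := by
  simp only [mFourier, chr, ContinuousMap.coe_mk, Fin.prod_univ_two, fourier_coe_apply]
  rw [← Complex.exp_add]
  congr 1
  push_cast
  ring

lemma setIntegral_eq_integral_torus (f : UnitAddTorus (Fin 2) → ℂ) :
    ∫ x in Icc (0 : Plane) 1, f (fun i => (x i : UnitAddCircle)) = ∫ t, f t := by
  rw [integral_preimage f 0]
  have : {x : Fin 2 → ℝ | ∀ i, x i ∈ Ioc ((0 : Fin 2 → ℝ) i) ((0 : Fin 2 → ℝ) i + 1)} =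
      Set.pi univ fun i => Ioc ((0 : Fin 2 → ℝ) i) ((1 : Fin 2 → ℝ) i) := by
    ext x; simp [Set.mem_pi]
  rw [this]
  exact (setIntegral_congr_set Measure.univ_pi_Ioc_ae_eq_Icc).symm

lemma exists_torus_lift {f : Plane → ℂ} (hf : Continuous f) (h : TorusPeriodic f) :
    ∃ G : C(UnitAddTorus (Fin 2), ℂ), ∀ x : Plane, G (fun i => (x i : UnitAddCircle)) = f x := by
  have hq : IsOpenQuotientMap (fun (x : Plane) (i : Fin 2) => (x i : UnitAddCircle)) :=
    IsOpenQuotientMap.piMap fun _ => QuotientAddGroup.isOpenQuotientMap_mk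
  have hl : ∀ x y : Plane, (fun i => (x i : UnitAddCircle)) = (fun i => (y i : UnitAddCircle)) →
      f x = f y := by
    intro x y hxy
    refine h x y fun i => ?_
    have := congrFun hxy i
    rw [eq_comm, QuotientAddGroup.eq] at this
    obtain ⟨n, hn⟩ := AddSubgroup.mem_zmultiples_iff.1 this
    exact ⟨n, by simp at hn; linarith⟩
  have hq' : Topology.IsQuotientMap (⟨_, hq.continuous⟩ : C(Plane, UnitAddTorus (Fin 2))) :=
    hq.isQuotientMap
  have hfac : Function.FactorsThrough (⟨f, hf⟩ : C(Plane, ℂ))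
      (⟨_, hq.continuous⟩ : C(Plane, UnitAddTorus (Fin 2))) := fun x y hxy => hl x y hxy
  exact ⟨hq'.lift ⟨f, hf⟩ hfac, fun x =>
    congrFun (congrArg DFunLike.coe (hq'.lift_comp ⟨f, hf⟩ hfac)) x⟩

lemma coef_eq_mFourierCoeff {f : Plane → ℂ} {G : C(UnitAddTorus (Fin 2), ℂ)}
    (hG : ∀ x : Plane, G (fun i => (x i : UnitAddCircle)) = f x) (k : Fin 2 → ℤ) :
    coef f k = mFourierCoeff G k := by
  rw [mFourierCoeff, ← setIntegral_eq_integral_torus]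
  simp only [coef, mFourier_coe, hG, smul_eq_mul]

/-- Parseval's identity. -/
lemma hasSum_sq_coef {f : Plane → ℂ} (hf : Continuous f) (h : TorusPeriodic f) :
    HasSum (fun k => ‖coef f k‖ ^ 2) (∫ x in Icc (0 : Plane) 1, ‖f x‖ ^ 2) := by
  obtain ⟨G, hG⟩ := exists_torus_lift hf h
  have h1 := hasSum_sq_mFourierCoeff (G.toLp 2 volume ℂ)
  simp only [mFourierCoeff_toLp, ← coef_eq_mFourierCoeff hG] at h1
  convert h1 using 1
  have h2 : ∫ t, ‖(G.toLp 2 volume ℂ : UnitAddTorus (Fin 2) → ℂ) t‖ ^ 2 = ∫ t, ‖G t‖ ^ 2 := by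
    refine integral_congr_ae ?_
    filter_upwards [ContinuousMap.coeFn_toLp (p := 2) (𝕜 := ℂ) volume G] with t ht
    rw [ht]
  rw [h2]
  have h3 := setIntegral_eq_integral_torus fun t => ((‖G t‖ ^ 2 : ℝ) : ℂ)
  simp only [hG] at h3
  rw [integral_complex_ofReal, integral_complex_ofReal] at h3
  exact_mod_cast h3

lemma hasSum_coef_mul_chr {f : Plane → ℂ} (hf : Continuous f) (h : TorusPeriodic f)
    (hs : Summable (coef f)) (x : Plane) : HasSum (fun k => coef f k * chr k x) (f x) := by
  obtain ⟨G, hG⟩ := exists_torus_lift hf h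
  have e : coef f = mFourierCoeff G := funext (coef_eq_mFourierCoeff hG)
  have := hasSum_mFourier_series_apply_of_summable (f := G) (e ▸ hs) (fun i => (x i : UnitAddCircle))
  simpa only [← coef_eq_mFourierCoeff hG, mFourier_coe, hG, smul_eq_mul] using this

/-- The series converges uniformly, hence in `L²`, where pairing with the `k`-th character is
continuous and picks out one term. -/
lemma coef_synth {a : (Fin 2 → ℤ) → ℂ} (ha : Summable a) (k : Fin 2 → ℤ) :
    coef (synth a) k = a k := by
  have hs : Summable fun l => a l • (mFourier l : C(UnitAddTorus (Fin 2), ℂ)) := by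
    refine .of_norm ?_
    simpa only [norm_smul, mFourier_norm, mul_one] using ha.norm
  set G := ∑' l, a l • (mFourier l : C(UnitAddTorus (Fin 2), ℂ)) with hGdef
  have hG : ∀ x : Plane, G (fun i => (x i : UnitAddCircle)) = synth a x := by
    intro x
    have := (ContinuousMap.hasSum_apply hs.hasSum (fun i => (x i : UnitAddCircle))).tsum_eq
    rw [hGdef, ← this]
    simp [synth, mFourier_coe]
  rw [coef_eq_mFourierCoeff hG, ← mFourierCoeff_toLp, ← mFourierBasis_repr]
  have h2 := ((ContinuousMap.toLp (E := ℂ) 2 volume ℂ).hasSum hs.hasSum)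
  have h3 := (innerSL ℂ (mFourierBasis (d := Fin 2) k)).hasSum h2
  have h4 : ∀ l, innerSL ℂ (mFourierBasis (d := Fin 2) k)
      (ContinuousMap.toLp (E := ℂ) 2 volume ℂ (a l • mFourier l)) = if l = k then a k else 0 := by
    intro l
    have : ContinuousMap.toLp (E := ℂ) 2 volume ℂ (a l • mFourier l) =
        a l • mFourierBasis (d := Fin 2) l := by
      rw [map_smul, coe_mFourierBasis]
    rw [this, map_smul, innerSL_apply_apply,
      orthonormal_iff_ite.1 (mFourierBasis (d := Fin 2)).orthonormal]
    by_cases hlk : l = k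
    · simp [hlk]
    · simp [hlk, Ne.symm hlk]
  rw [HilbertBasis.repr_apply_apply]
  refine HasSum.unique (h3.congr_fun ?_) (hasSum_ite_eq k (a k))
  intro l
  exact (h4 l).symm

end Bridge

end FrameEnergy

end

noncomputable section

open MeasureTheory Set ComplexConjugate

namespace FrameEnergy

/-! ### Rapidly decreasing Fourier coefficients -/

/-- The complex-valued covector `A dx₁ + B dx₂`. -/
def covec (A B : ℂ) : Plane →L[ℝ] ℂ :=
  (ContinuousLinearMap.proj (R := ℝ) (φ := fun _ : Fin 2 => ℝ) 0).smulRight A +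
    (ContinuousLinearMap.proj (R := ℝ) (φ := fun _ : Fin 2 => ℝ) 1).smulRight B

lemma covec_apply (A B : ℂ) (v : Plane) : covec A B v = v 0 * A + v 1 * B := by
  simp [covec]

lemma covec_single_zero (A B : ℂ) : covec A B (Pi.single 0 1) = A := by simp [covec_apply]

lemma covec_single_one (A B : ℂ) : covec A B (Pi.single 1 1) = B := by simp [covec_apply]

lemma eq_covec (L : Plane →L[ℝ] ℂ) : L = covec (L (Pi.single 0 1)) (L (Pi.single 1 1)) := by
  ext v
  have hv : v = v 0 • Pi.single 0 1 + v 1 • Pi.single 1 1 := by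
    ext i; fin_cases i <;> simp
  rw [covec_apply]
  conv_lhs => rw [hv]
  simp

lemma norm_covec_le (A B : ℂ) : ‖covec A B‖ ≤ ‖A‖ + ‖B‖ := by
  refine ContinuousLinearMap.opNorm_le_bound _ (by positivity) fun v => ?_
  rw [covec_apply]
  have h0 : ‖(v 0 : ℂ)‖ ≤ ‖v‖ := by simpa using norm_le_pi_norm v 0
  have h1 : ‖(v 1 : ℂ)‖ ≤ ‖v‖ := by simpa using norm_le_pi_norm v 1
  calc ‖(v 0 : ℂ) * A + v 1 * B‖ ≤ ‖(v 0 : ℂ)‖ * ‖A‖ + ‖(v 1 : ℂ)‖ * ‖B‖ := by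
        rw [← norm_mul, ← norm_mul]; exact norm_add_le _ _
    _ ≤ ‖v‖ * ‖A‖ + ‖v‖ * ‖B‖ := by gcongr
    _ = _ := by ring

lemma contDiff_covec {X : Type*} [NormedAddCommGroup X] [NormedSpace ℝ X] {n : WithTop ℕ∞}
    {A B : X → ℂ} (hA : ContDiff ℝ n A) (hB : ContDiff ℝ n B) :
    ContDiff ℝ n fun x => covec (A x) (B x) :=
  (contDiff_const.smulRight hA).add (contDiff_const.smulRight hB)

/-- Rapidly decreasing double sequences. -/
def Rapid (a : (Fin 2 → ℤ) → ℂ) : Prop := ∀ j : ℕ, ∃ C, ∀ k, (1 + ‖k‖) ^ j * ‖a k‖ ≤ C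

/-- The symbol of `∂_{x_i}`. -/
def dsym (i : Fin 2) (k : Fin 2 → ℤ) : ℂ := 2 * Real.pi * Complex.I * k i

/-- Differentiation on the side of Fourier coefficients. -/
def dcoef (i : Fin 2) (a : (Fin 2 → ℤ) → ℂ) (k : Fin 2 → ℤ) : ℂ := dsym i k * a k

lemma norm_dsym (i : Fin 2) (k : Fin 2 → ℤ) : ‖dsym i k‖ = 2 * Real.pi * ‖k i‖ := by
  simp [dsym, abs_of_pos Real.pi_pos, Complex.norm_intCast, Int.norm_eq_abs]

lemma norm_dsym_le (i : Fin 2) (k : Fin 2 → ℤ) : ‖dsym i k‖ ≤ 2 * Real.pi * (1 + ‖k‖) := by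
  rw [norm_dsym]
  have := norm_le_pi_norm k i
  gcongr
  linarith

/-- The exponent 3 exceeds the rank 2 of the lattice; this is the source of the weight 3 wherever
absolute convergence is needed. -/
lemma summable_one_add_norm_inv : Summable fun k : Fin 2 → ℤ => ((1 + ‖k‖) ^ 3)⁻¹ := by
  have h := EisensteinSeries.summable_one_div_norm_rpow (k := 3) (by norm_num)
  refine Summable.of_norm_bounded_eventually h ?_
  filter_upwards [(Set.finite_singleton (0 : Fin 2 → ℤ)).compl_mem_cofinite] with k hk
  have hk : 0 < ‖k‖ := norm_pos_iff.2 hk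
  have : ‖k‖ ^ (-3 : ℝ) = (‖k‖ ^ 3)⁻¹ := by
    rw [Real.rpow_neg hk.le]; norm_cast
  rw [this, norm_inv, norm_pow, Real.norm_of_nonneg (by positivity)]
  gcongr
  linarith

lemma Rapid.of_le {a b : (Fin 2 → ℤ) → ℂ} (ha : Rapid a) (h : ∀ k, ‖b k‖ ≤ ‖a k‖) : Rapid b := by
  intro j
  obtain ⟨C, hC⟩ := ha j
  exact ⟨C, fun k => (mul_le_mul_of_nonneg_left (h k) (by positivity)).trans (hC k)⟩

lemma Rapid.dcoef {a : (Fin 2 → ℤ) → ℂ} (ha : Rapid a) (i : Fin 2) : Rapid (dcoef i a) := by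
  intro j
  obtain ⟨C, hC⟩ := ha (j + 1)
  refine ⟨2 * Real.pi * C, fun k => ?_⟩
  rw [FrameEnergy.dcoef, norm_mul]
  calc (1 + ‖k‖) ^ j * (‖dsym i k‖ * ‖a k‖)
      ≤ (1 + ‖k‖) ^ j * (2 * Real.pi * (1 + ‖k‖) * ‖a k‖) := by
        gcongr; exact norm_dsym_le i k
    _ = 2 * Real.pi * ((1 + ‖k‖) ^ (j + 1) * ‖a k‖) := by ring
    _ ≤ _ := by gcongr; exact hC k

lemma summable_of_cube_bound {a : (Fin 2 → ℤ) → ℂ} {C : ℝ}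
    (hC : ∀ k, (1 + ‖k‖) ^ 3 * ‖a k‖ ≤ C) : Summable fun k => ‖a k‖ := by
  refine Summable.of_nonneg_of_le (fun k => norm_nonneg _) (fun k => ?_)
    (summable_one_add_norm_inv.mul_left C)
  rw [← div_eq_mul_inv, le_div_iff₀ (by positivity), mul_comm]
  exact hC k

lemma Rapid.summable_norm {a : (Fin 2 → ℤ) → ℂ} (ha : Rapid a) : Summable fun k => ‖a k‖ :=
  let ⟨_, hC⟩ := ha 3
  summable_of_cube_bound hC

lemma Rapid.summable {a : (Fin 2 → ℤ) → ℂ} (ha : Rapid a) : Summable a :=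
  ha.summable_norm.of_norm

lemma norm_chr (k : Fin 2 → ℤ) (x : Plane) : ‖chr k x‖ = 1 := by
  have : (2 * Real.pi * Complex.I * (k 0 * x 0 + k 1 * x 1) : ℂ) =
      ((2 * Real.pi * (k 0 * x 0 + k 1 * x 1) : ℝ) : ℂ) * Complex.I := by push_cast; ring
  rw [chr, this, Complex.norm_exp_ofReal_mul_I]

lemma hasFDerivAt_chr (k : Fin 2 → ℤ) (x : Plane) :
    HasFDerivAt (chr k) (covec (dsym 0 k * chr k x) (dsym 1 k * chr k x)) x := by
  have h : HasFDerivAt (fun y : Plane => covec (dsym 0 k) (dsym 1 k) y)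
      (covec (dsym 0 k) (dsym 1 k)) x := (covec (dsym 0 k) (dsym 1 k)).hasFDerivAt
  have h2 := h.cexp
  refine (h2.congr_fderiv ?_).congr_of_eventuallyEq (.of_forall fun y => ?_)
  · ext v
    simp only [covec_apply, _root_.smul_apply, chr, dsym, smul_eq_mul]
    ring_nf
  · simp only [chr, covec_apply, dsym]
    ring_nf

lemma contDiff_chr (k : Fin 2 → ℤ) : ContDiff ℝ ∞ (chr k) := by
  have h : chr k = fun y : Plane => Complex.exp (covec (dsym 0 k) (dsym 1 k) y) := by
    ext y
    simp only [chr, covec_apply, dsym]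
    ring_nf
  rw [h]
  exact (covec (dsym 0 k) (dsym 1 k)).contDiff.cexp

lemma torusPeriodic_chr (k : Fin 2 → ℤ) : TorusPeriodic (chr k) := by
  intro x y h
  obtain ⟨l, rfl⟩ := sameTorusPoint_iff.1 h
  have : (2 * Real.pi * Complex.I * (k 0 * (y + fun i => (l i : ℝ)) 0 +
      k 1 * (y + fun i => (l i : ℝ)) 1 : ℂ) : ℂ) =
      2 * Real.pi * Complex.I * (k 0 * y 0 + k 1 * y 1) +
      ((k 0 * l 0 + k 1 * l 1 : ℤ) : ℂ) * (2 * Real.pi * Complex.I) := by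
    simp; ring
  rw [chr, this, Complex.exp_add, Complex.exp_int_mul_two_pi_mul_I, mul_one, chr]

lemma hasFDerivAt_synth {a : (Fin 2 → ℤ) → ℂ} (ha : Rapid a) (x : Plane) :
    HasFDerivAt (synth a) (covec (synth (dcoef 0 a) x) (synth (dcoef 1 a) x)) x := by
  have hs : ∀ {b : (Fin 2 → ℤ) → ℂ}, Rapid b → ∀ x, Summable fun k => b k * chr k x :=
    fun hb x => .of_norm (by simpa [norm_chr] using hb.summable_norm)
  have h := hasFDerivAt_tsum (𝕜 := ℝ) (f := fun k y => a k * chr k y)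
    (f' := fun k y => covec (dcoef 0 a k * chr k y) (dcoef 1 a k * chr k y))
    (u := fun k => ‖dcoef 0 a k‖ + ‖dcoef 1 a k‖)
    ((ha.dcoef 0).summable_norm.add (ha.dcoef 1).summable_norm)
    (fun k y => by
      refine ((hasFDerivAt_chr k y).const_mul (a k)).congr_fderiv ?_
      ext v
      simp only [covec_apply, _root_.smul_apply, dcoef, smul_eq_mul]
      ring)
    (fun k y => by simpa [norm_chr] using norm_covec_le (dcoef 0 a k * chr k y) (dcoef 1 a k * chr k y))
    (hs ha 0) x
  refine h.congr_fderiv ?_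
  have hsum : HasSum (fun k => covec (dcoef 0 a k * chr k x) (dcoef 1 a k * chr k x))
      (covec (synth (dcoef 0 a) x) (synth (dcoef 1 a) x)) := by
    have e (P : Plane →L[ℝ] ℝ) : Continuous fun z : ℂ => P.smulRight z :=
      (ContinuousLinearMap.smulRightL ℝ Plane ℂ P).continuous
    have m (P : Plane →L[ℝ] ℝ) {b} (hb : Rapid b) := (hs hb x).hasSum.map
      (ContinuousLinearMap.smulRightL ℝ Plane ℂ P) (ContinuousLinearMap.continuous _)
    exact (m _ (ha.dcoef 0)).add (m _ (ha.dcoef 1))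
  exact hsum.tsum_eq

lemma fderiv_synth {a : (Fin 2 → ℤ) → ℂ} (ha : Rapid a) (x : Plane) (i : Fin 2) :
    fderiv ℝ (synth a) x (Pi.single i 1) = synth (dcoef i a) x := by
  rw [(hasFDerivAt_synth ha x).fderiv]
  fin_cases i
  · exact covec_single_zero _ _
  · exact covec_single_one _ _

lemma contDiff_synth {a : (Fin 2 → ℤ) → ℂ} (ha : Rapid a) : ContDiff ℝ ∞ (synth a) := by
  refine contDiff_infty.2 fun n => ?_
  induction n generalizing a with
  | zero =>
    exact contDiff_zero.2 (continuous_iff_continuousAt.2 fun x => (hasFDerivAt_synth ha x).continuousAt)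
  | succ n ih =>
    rw [Nat.cast_add, Nat.cast_one, contDiff_succ_iff_hasFDerivAt]
    exact ⟨_, contDiff_covec (ih (ha.dcoef 0)) (ih (ha.dcoef 1)), hasFDerivAt_synth ha⟩

lemma torusPeriodic_synth (a : (Fin 2 → ℤ) → ℂ) : TorusPeriodic (synth a) := fun x y h => by
  simp only [synth, torusPeriodic_chr _ x y h]

lemma norm_coef_le {f : Plane → ℂ} (hf : Continuous f) (h : TorusPeriodic f) :
    ∃ C, ∀ k, ‖coef f k‖ ≤ C := by
  obtain ⟨x₀, hx₀⟩ := (h.comp fun z => ‖z‖).exists_bound hf.norm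
  refine ⟨‖f x₀‖ * volume.real (Icc (0 : Plane) 1), fun k => ?_⟩
  refine norm_setIntegral_le_of_norm_le_const isCompact_Icc.measure_lt_top fun x _ => ?_
  rw [norm_mul, norm_chr, one_mul]
  exact hx₀ x

/-- Integration by parts: the derivative of the periodic function `chr (-k) * f` has integral zero.
-/
lemma coef_fderiv {f : Plane → ℂ} (hf : ContDiff ℝ 1 f) (h : TorusPeriodic f) (i : Fin 2) :
    coef (fun x => fderiv ℝ f x (Pi.single i 1)) = dcoef i (coef f) := by
  ext k
  have hc := (contDiff_chr (-k)).of_le (m := 1) (by exact_mod_cast le_top)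
  have key := integral_fderiv_single_eq_zero (f := fun x => chr (-k) x * f x) (hc.mul hf)
    ((torusPeriodic_chr _).comp₂ h _) i
  have e : ∀ x, fderiv ℝ (fun x => chr (-k) x * f x) x (Pi.single i 1) =
      chr (-k) x * fderiv ℝ f x (Pi.single i 1) - dsym i k * (chr (-k) x * f x) := by
    intro x
    have hd : HasFDerivAt (fun x => chr (-k) x * f x) _ x :=
      (hasFDerivAt_chr (-k) x).mul (hf.differentiable one_ne_zero x).hasFDerivAt
    rw [hd.fderiv]
    have : covec (dsym 0 (-k) * chr (-k) x) (dsym 1 (-k) * chr (-k) x) (Pi.single i 1) =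
        - dsym i k * chr (-k) x := by
      fin_cases i
      · rw [Fin.zero_eta, covec_single_zero]; simp [dsym]
      · rw [Fin.mk_one, covec_single_one]; simp [dsym]
    simp only [_root_.add_apply, _root_.smul_apply, this, smul_eq_mul]
    ring
  simp only [e] at key
  have c1 : Continuous fun x => chr (-k) x * fderiv ℝ f x (Pi.single i 1) :=
    hc.continuous.mul ((hf.continuous_fderiv one_ne_zero).clm_apply continuous_const)
  have c2 : Continuous fun x => dsym i k * (chr (-k) x * f x) :=
    continuous_const.mul (hc.continuous.mul hf.continuous)
  rw [integral_sub c1.integrableOn_Icc c2.integrableOn_Icc, integral_const_mul, sub_eq_zero] at key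
  exact key

/-- Smooth periodic functions. -/
structure SmoothPer (f : Plane → ℂ) : Prop where
  smooth : ContDiff ℝ ∞ f
  periodic : TorusPeriodic f

lemma SmoothPer.fderiv {f : Plane → ℂ} (h : SmoothPer f) (i : Fin 2) :
    SmoothPer fun x => fderiv ℝ f x (Pi.single i 1) :=
  ⟨(h.smooth.fderiv_right (m := ∞) (by simp)).clm_apply contDiff_const,
    h.periodic.fderiv.comp fun L => L (Pi.single i 1)⟩

lemma SmoothPer.mul {f g : Plane → ℂ} (hf : SmoothPer f) (hg : SmoothPer g) :
    SmoothPer fun x => f x * g x :=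
  ⟨hf.smooth.mul hg.smooth, hf.periodic.comp₂ hg.periodic _⟩

lemma Rapid.smoothPer {a : (Fin 2 → ℤ) → ℂ} (ha : Rapid a) : SmoothPer (synth a) :=
  ⟨contDiff_synth ha, torusPeriodic_synth a⟩

lemma norm_iterate_dcoef (i : Fin 2) (j : ℕ) (a : (Fin 2 → ℤ) → ℂ) (k : Fin 2 → ℤ) :
    ‖((dcoef i)^[j] a) k‖ = (2 * Real.pi * ‖k i‖) ^ j * ‖a k‖ := by
  induction j with
  | zero => simp
  | succ j ih =>
    rw [Function.iterate_succ_apply', dcoef, norm_mul, ih, norm_dsym]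
    ring

/-- The sup norm of `k` is attained by one coordinate, so pure derivatives in the two directions
control every weight and mixed derivatives are never needed. -/
lemma pow_mul_norm_le (a : (Fin 2 → ℤ) → ℂ) (j : ℕ) (k : Fin 2 → ℤ) :
    (1 + ‖k‖) ^ j * ‖a k‖ ≤
      2 ^ j * (‖a k‖ + ‖((dcoef 0)^[j] a) k‖ + ‖((dcoef 1)^[j] a) k‖) := by
  have h1 : (1 + ‖k‖) ^ j ≤ 2 ^ j * (1 + ‖k‖ ^ j) := by
    refine (add_pow_le zero_le_one (norm_nonneg k) j).trans ?_
    rw [one_pow]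
    gcongr
    · norm_num
    · omega
  have hi : ∀ i, ‖k i‖ ^ j * ‖a k‖ ≤ ‖((dcoef i)^[j] a) k‖ := by
    intro i
    rw [norm_iterate_dcoef]
    gcongr
    nlinarith [Real.pi_gt_three, norm_nonneg (k i)]
  have h2 : ‖k‖ ^ j * ‖a k‖ ≤ ‖((dcoef 0)^[j] a) k‖ + ‖((dcoef 1)^[j] a) k‖ := by
    rcases le_total ‖k 0‖ ‖k 1‖ with h | h
    · have : ‖k‖ ≤ ‖k 1‖ :=
        (pi_norm_le_iff_of_nonneg (norm_nonneg _)).2 (Fin.forall_fin_two.2 ⟨h, le_rfl⟩)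
      have : ‖k‖ ^ j * ‖a k‖ ≤ ‖k 1‖ ^ j * ‖a k‖ := by gcongr
      linarith [hi 1, norm_nonneg (((dcoef 0)^[j] a) k)]
    · have : ‖k‖ ≤ ‖k 0‖ :=
        (pi_norm_le_iff_of_nonneg (norm_nonneg _)).2 (Fin.forall_fin_two.2 ⟨le_rfl, h⟩)
      have : ‖k‖ ^ j * ‖a k‖ ≤ ‖k 0‖ ^ j * ‖a k‖ := by gcongr
      linarith [hi 0, norm_nonneg (((dcoef 1)^[j] a) k)]
  calc (1 + ‖k‖) ^ j * ‖a k‖ ≤ 2 ^ j * (1 + ‖k‖ ^ j) * ‖a k‖ := by gcongr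
    _ = 2 ^ j * (‖a k‖ + ‖k‖ ^ j * ‖a k‖) := by ring
    _ ≤ 2 ^ j * (‖a k‖ + (‖((dcoef 0)^[j] a) k‖ + ‖((dcoef 1)^[j] a) k‖)) := by gcongr
    _ = _ := by ring

lemma rapid_of_dcoef_bound {a : (Fin 2 → ℤ) → ℂ}
    (h : ∀ i j, ∃ C, ∀ k, ‖((dcoef i)^[j] a) k‖ ≤ C) : Rapid a := by
  intro j
  obtain ⟨C, hC⟩ := h 0 0
  obtain ⟨C0, hC0⟩ := h 0 j
  obtain ⟨C1, hC1⟩ := h 1 j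
  refine ⟨2 ^ j * (C + C0 + C1), fun k => (pow_mul_norm_le a j k).trans ?_⟩
  gcongr
  exacts [hC k, hC0 k, hC1 k]

lemma SmoothPer.rapid {f : Plane → ℂ} (h : SmoothPer f) : Rapid (coef f) := by
  refine rapid_of_dcoef_bound fun i j => ?_
  induction j generalizing f with
  | zero => exact norm_coef_le h.smooth.continuous h.periodic
  | succ j ih =>
    rw [Function.iterate_succ_apply, ← coef_fderiv (h.smooth.of_le (by exact_mod_cast le_top)) h.periodic]
    exact ih (h.fderiv i)

lemma SmoothPer.synth_coef {f : Plane → ℂ} (h : SmoothPer f) : synth (coef f) = f :=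
  funext fun x => (hasSum_coef_mul_chr h.smooth.continuous h.periodic h.rapid.summable x).tsum_eq

end FrameEnergy

end

noncomputable section

open MeasureTheory Set ComplexConjugate

namespace FrameEnergy

/-! ### The Beltrami equation on the torus -/

/-- The Fourier multiplier `∂ ∂̄⁻¹`, completed at the zero mode so as to be isometric. -/
def beur (a : (Fin 2 → ℤ) → ℂ) (k : Fin 2 → ℤ) : ℂ :=
  if k = 0 then -conj (a 0) else (k 0 - Complex.I * k 1) / (k 0 + Complex.I * k 1) * a k

lemma int_add_I_mul_int_ne_zero {k : Fin 2 → ℤ} (hk : k ≠ 0) :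
    ((k 0 : ℂ) + Complex.I * k 1) ≠ 0 := by
  intro h
  apply hk
  have h0 := congrArg Complex.re h
  have h1 := congrArg Complex.im h
  simp at h0 h1
  ext i
  fin_cases i
  · simpa using h0
  · simpa using h1

/-- Numerator and denominator of the symbol are complex conjugates. The conjugation at the zero mode
makes `beur` only real linear, but still isometric. -/
lemma norm_beur (a : (Fin 2 → ℤ) → ℂ) (k : Fin 2 → ℤ) : ‖beur a k‖ = ‖a k‖ := by
  by_cases hk : k = 0
  · simp [beur, hk]
  · have h := int_add_I_mul_int_ne_zero hk
    have h2 : conj ((k 0 : ℂ) + Complex.I * k 1) = k 0 - Complex.I * k 1 := by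
      simp [sub_eq_add_neg]
    rw [beur, if_neg hk, ← h2, norm_mul, norm_div, Complex.norm_conj, div_self (norm_ne_zero_iff.2 h),
      one_mul]

lemma Rapid.beur {a : (Fin 2 → ℤ) → ℂ} (ha : Rapid a) : Rapid (beur a) :=
  ha.of_le fun k => (norm_beur a k).le

lemma beur_dcoef (i : Fin 2) (a : (Fin 2 → ℤ) → ℂ) : beur (dcoef i a) = dcoef i (beur a) := by
  ext k
  by_cases hk : k = 0
  · simp [beur, hk, dcoef, dsym]
  · simp only [beur, if_neg hk, dcoef]; ring

lemma hasSum_beur {v : ℕ → (Fin 2 → ℤ) → ℂ} {w : (Fin 2 → ℤ) → ℂ}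
    (h : ∀ k, HasSum (fun n => v n k) (w k)) (k : Fin 2 → ℤ) :
    HasSum (fun n => beur (v n) k) (beur w k) := by
  by_cases hk : k = 0
  · subst hk
    simp only [beur, if_true]
    exact (Complex.hasSum_conj'.2 (h 0)).neg
  · simp only [beur, if_neg hk]
    exact (h k).mul_left _

/-- The `ℓ²` norm of a double sequence. -/
def nrm (a : (Fin 2 → ℤ) → ℂ) : ℝ := Real.sqrt (∑' k, ‖a k‖ ^ 2)

lemma nrm_nonneg (a : (Fin 2 → ℤ) → ℂ) : 0 ≤ nrm a := Real.sqrt_nonneg _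

lemma Rapid.summable_sq {a : (Fin 2 → ℤ) → ℂ} (ha : Rapid a) : Summable fun k => ‖a k‖ ^ 2 := by
  have : HasSum _ _ := hasSum_sq_coef ha.smoothPer.smooth.continuous ha.smoothPer.periodic
  simpa only [coef_synth ha.summable] using this.summable

lemma norm_le_nrm {a : (Fin 2 → ℤ) → ℂ} (ha : Rapid a) (k : Fin 2 → ℤ) : ‖a k‖ ≤ nrm a :=
  Real.le_sqrt_of_sq_le (ha.summable_sq.le_tsum k fun _ _ => by positivity)

lemma Rapid.add {a b : (Fin 2 → ℤ) → ℂ} (ha : Rapid a) (hb : Rapid b) : Rapid (a + b) := by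
  intro j
  obtain ⟨C, hC⟩ := ha j
  obtain ⟨C', hC'⟩ := hb j
  refine ⟨C + C', fun k => ?_⟩
  calc (1 + ‖k‖) ^ j * ‖a k + b k‖ ≤ (1 + ‖k‖) ^ j * (‖a k‖ + ‖b k‖) := by
        gcongr; exact norm_add_le _ _
    _ = (1 + ‖k‖) ^ j * ‖a k‖ + (1 + ‖k‖) ^ j * ‖b k‖ := by ring
    _ ≤ _ := add_le_add (hC k) (hC' k)

lemma nrm_add_le {a b : (Fin 2 → ℤ) → ℂ} (ha : Rapid a) (hb : Rapid b) :
    nrm (a + b) ≤ nrm a + nrm b := by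
  have h := Real.Lp_add_le_tsum_of_nonneg' (p := 2) (by norm_num) (fun k => norm_nonneg (a k))
    (fun k => norm_nonneg (b k)) (by simpa using ha.summable_sq) (by simpa using hb.summable_sq)
  simp only [Real.rpow_ofNat, ← Real.sqrt_eq_rpow] at h
  refine le_trans (Real.sqrt_le_sqrt ?_) h
  have hs : Summable fun k => (‖a k‖ + ‖b k‖) ^ 2 := by
    have := (Real.Lp_add_le_tsum_of_nonneg (p := 2) (by norm_num) (fun k => norm_nonneg (a k))
      (fun k => norm_nonneg (b k)) (by simpa using ha.summable_sq) (by simpa using hb.summable_sq)).1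
    simpa using this
  refine Summable.tsum_le_tsum (fun k => ?_) (ha.add hb).summable_sq hs
  gcongr
  exact norm_add_le _ _

/-- Multiplication by `ν` after the multiplier `beur`, on Fourier coefficients. -/
def step (ν : Plane → ℂ) (a : (Fin 2 → ℤ) → ℂ) : (Fin 2 → ℤ) → ℂ :=
  coef fun x => ν x * synth (beur a) x

lemma Rapid.smoothPer_mul {ν : Plane → ℂ} (hν : SmoothPer ν) {a : (Fin 2 → ℤ) → ℂ} (ha : Rapid a) :
    SmoothPer fun x => ν x * synth (FrameEnergy.beur a) x := hν.mul ha.beur.smoothPer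

lemma Rapid.step {ν : Plane → ℂ} (hν : SmoothPer ν) {a : (Fin 2 → ℤ) → ℂ} (ha : Rapid a) :
    Rapid (step ν a) := (ha.smoothPer_mul hν).rapid

lemma tsum_sq_coef {f : Plane → ℂ} (hf : SmoothPer f) :
    ∑' k, ‖coef f k‖ ^ 2 = ∫ x in Icc (0 : Plane) 1, ‖f x‖ ^ 2 :=
  (hasSum_sq_coef hf.smooth.continuous hf.periodic).tsum_eq

/-- Parseval twice: `beur` preserves the `L²` norm and multiplication by `ν` costs at most its sup
norm. This is the contraction behind the Neumann series. -/
lemma nrm_step_le {ν : Plane → ℂ} (hν : SmoothPer ν) {K : ℝ} (hK : ∀ x, ‖ν x‖ ≤ K)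
    {a : (Fin 2 → ℤ) → ℂ} (ha : Rapid a) : nrm (step ν a) ≤ K * nrm a := by
  have hK0 : 0 ≤ K := (norm_nonneg _).trans (hK 0)
  have e1 : ∑' k, ‖a k‖ ^ 2 = ∫ x in Icc (0 : Plane) 1, ‖synth (beur a) x‖ ^ 2 := by
    rw [← tsum_sq_coef ha.beur.smoothPer]
    simp only [coef_synth ha.beur.summable, norm_beur]
  rw [nrm, nrm, step, tsum_sq_coef (ha.smoothPer_mul hν), e1]
  refine Real.sqrt_le_iff.2 ⟨by positivity, ?_⟩
  rw [mul_pow, Real.sq_sqrt (by positivity), ← integral_const_mul]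
  have c1 := (ha.smoothPer_mul hν).smooth.continuous
  have c2 := ha.beur.smoothPer.smooth.continuous
  refine setIntegral_mono (c1.norm.pow 2).integrableOn_Icc
    (continuous_const.mul (c2.norm.pow 2)).integrableOn_Icc fun x => ?_
  simp only [norm_mul, mul_pow]
  gcongr
  exact hK x

lemma coef_add {f g : Plane → ℂ} (hf : Continuous f) (hg : Continuous g) :
    coef (fun x => f x + g x) = coef f + coef g := by
  ext k
  simp only [coef, Pi.add_apply, mul_add]
  exact integral_add ((contDiff_chr _).continuous.mul hf).integrableOn_Icc
    ((contDiff_chr _).continuous.mul hg).integrableOn_Icc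

lemma dcoef_step {ν : Plane → ℂ} (hν : SmoothPer ν) {a : (Fin 2 → ℤ) → ℂ} (ha : Rapid a)
    (i : Fin 2) : dcoef i (step ν a) =
      step (fun x => fderiv ℝ ν x (Pi.single i 1)) a + step ν (dcoef i a) := by
  have h := ha.smoothPer_mul hν
  have h1 := ha.smoothPer_mul (hν.fderiv i)
  have h2 := (ha.dcoef i).smoothPer_mul hν
  rw [step, ← coef_fderiv (h.smooth.of_le (by exact_mod_cast le_top)) h.periodic, step, step,
    ← coef_add h1.smooth.continuous h2.smooth.continuous]
  congr 1
  ext x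
  have hd : HasFDerivAt (fun x => ν x * synth (beur a) x) _ x :=
    ((hν.smooth.differentiable (by simp)) x).hasFDerivAt.mul
      ((ha.beur.smoothPer.smooth.differentiable (by simp)) x).hasFDerivAt
  rw [hd.fderiv]
  simp only [_root_.add_apply, _root_.smul_apply, smul_eq_mul, fderiv_synth ha.beur, beur_dcoef]
  ring

lemma dcoef_add (i : Fin 2) (a b : (Fin 2 → ℤ) → ℂ) : dcoef i (a + b) = dcoef i a + dcoef i b := by
  ext k; simp [dcoef, mul_add]

lemma iterate_dcoef_add (i : Fin 2) (j : ℕ) (a b : (Fin 2 → ℤ) → ℂ) :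
    (dcoef i)^[j] (a + b) = (dcoef i)^[j] a + (dcoef i)^[j] b := by
  induction j generalizing a b with
  | zero => rfl
  | succ j ih => simp only [Function.iterate_succ_apply, dcoef_add, ih]

lemma Rapid.iterate_dcoef {a : (Fin 2 → ℤ) → ℂ} (ha : Rapid a) (i : Fin 2) (j : ℕ) :
    Rapid ((FrameEnergy.dcoef i)^[j] a) := by
  induction j generalizing a with
  | zero => exact ha
  | succ j ih => exact ih (ha.dcoef i)

/-- By the Leibniz rule, the only term with all `j` derivatives on `a` keeps the constant `K`;
derivatives falling on `ν` cost a large `M` but involve lower orders only. Keeping `K` at top order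
is what preserves the contraction. -/
lemma nrm_iterate_dcoef_step_le (i : Fin 2) (j : ℕ) {ν : Plane → ℂ} (hν : SmoothPer ν) {K : ℝ}
    (hK : ∀ x, ‖ν x‖ ≤ K) : ∃ M, 0 ≤ M ∧ ∀ a, Rapid a →
      nrm ((dcoef i)^[j] (step ν a)) ≤ K * nrm ((dcoef i)^[j] a) +
        M * ∑ l ∈ Finset.range j, nrm ((dcoef i)^[l] a) := by
  induction j generalizing ν K with
  | zero => exact ⟨0, le_rfl, fun a ha => by simpa using nrm_step_le hν hK ha⟩
  | succ j ih =>
    have hd := hν.fderiv i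
    obtain ⟨x₀, hx₀⟩ := (hd.periodic.comp fun z => ‖z‖).exists_bound hd.smooth.continuous.norm
    obtain ⟨M1, hM1, h1⟩ := ih hd hx₀
    obtain ⟨M2, hM2, h2⟩ := ih hν hK
    set K1 := ‖fderiv ℝ ν x₀ (Pi.single i 1)‖
    have hK1 : 0 ≤ K1 := norm_nonneg _
    refine ⟨K1 + M1 + M2, by positivity, fun a ha => ?_⟩
    rw [Function.iterate_succ_apply, dcoef_step hν ha, iterate_dcoef_add]
    have t := nrm_add_le ((ha.step hd).iterate_dcoef i j) (((ha.dcoef i).step hν).iterate_dcoef i j)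
    have e1 := h1 a ha
    have e2 := h2 _ (ha.dcoef i)
    simp only [← Function.iterate_succ_apply] at e2
    set s : ℕ → ℝ := fun l => nrm ((dcoef i)^[l] a) with hs
    have hs0 : ∀ l, 0 ≤ s l := fun l => nrm_nonneg _
    have b1 : s j ≤ ∑ l ∈ Finset.range (j + 1), s l :=
      Finset.single_le_sum (fun l _ => hs0 l) (by simp)
    have b2 : ∑ l ∈ Finset.range j, s l ≤ ∑ l ∈ Finset.range (j + 1), s l := by
      rw [Finset.sum_range_succ]; linarith [hs0 j]
    have b3 : ∑ l ∈ Finset.range j, s (l + 1) ≤ ∑ l ∈ Finset.range (j + 1), s l := by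
      rw [Finset.sum_range_succ']; linarith [hs0 0]
    change nrm _ ≤ K1 * s j + M1 * ∑ l ∈ Finset.range j, s l at e1
    change nrm _ ≤ K * s (j + 1) + M2 * ∑ l ∈ Finset.range j, s (l + 1) at e2
    change _ ≤ K * s (j + 1) + _ * ∑ l ∈ Finset.range (j + 1), s l
    nlinarith [mul_le_mul_of_nonneg_left b1 hK1, mul_le_mul_of_nonneg_left b2 hM1,
      mul_le_mul_of_nonneg_left b3 hM2]

lemma Rapid.iterate_step {μ : Plane → ℂ} (hμ : SmoothPer μ) {b : (Fin 2 → ℤ) → ℂ} (hb : Rapid b)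
    (n : ℕ) : Rapid ((FrameEnergy.step μ)^[n] b) := by
  induction n with
  | zero => exact hb
  | succ n ih => rw [Function.iterate_succ_apply']; exact ih.step hμ

/-- A forcing term of rate `r` strictly above the contraction factor `K` does not spoil decay of
rate `r`; `A` is chosen so that `K A + C ≤ r A`. -/
lemma geometric_of_recurrence {s : ℕ → ℝ} {K r C : ℝ} (hKr : K < r) (hK : 0 ≤ K)
    (h : ∀ n, s (n + 1) ≤ K * s n + C * r ^ n) :
    ∃ A, 0 ≤ A ∧ ∀ n, s n ≤ A * r ^ n := by
  have hr : 0 < r := hK.trans_lt hKr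
  have hd : 0 < r - K := sub_pos.2 hKr
  refine ⟨max (max 0 (s 0)) (C / (r - K)), (le_max_left _ _).trans (le_max_left _ _),
    fun n => ?_⟩
  set A := max (max 0 (s 0)) (C / (r - K))
  have hA : C ≤ A * (r - K) := (div_le_iff₀ hd).1 (le_max_right _ _)
  induction n with
  | zero =>
    rw [pow_zero, mul_one]
    exact (le_max_right 0 (s 0)).trans (le_max_left _ (C / (r - K)))
  | succ n ih =>
    calc s (n + 1) ≤ K * (A * r ^ n) + C * r ^ n :=
          (h n).trans (by gcongr)
      _ ≤ K * (A * r ^ n) + A * (r - K) * r ^ n := by gcongr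
      _ = _ := by ring

/-- Strong induction on the order `j`: the lower orders already decay like `r ^ n` and act as
forcing in the recurrence for order `j`. The rate is the same for all `j`; only the constant `A`
depends on `j`. -/
lemma nrm_iterate_dcoef_iterate_step_le {μ : Plane → ℂ} (hμ : SmoothPer μ) {K r : ℝ}
    (hK : ∀ x, ‖μ x‖ ≤ K) (hKr : K < r) {b : (Fin 2 → ℤ) → ℂ} (hb : Rapid b) (i : Fin 2) (j : ℕ) :
    ∃ A, 0 ≤ A ∧ ∀ n, nrm ((dcoef i)^[j] ((step μ)^[n] b)) ≤ A * r ^ n := by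
  have hK0 : 0 ≤ K := (norm_nonneg _).trans (hK 0)
  induction j using Nat.strong_induction_on with
  | _ j ih =>
    choose! A hA0 hA using ih
    obtain ⟨M, hM0, hM⟩ := nrm_iterate_dcoef_step_le i j hμ hK
    refine geometric_of_recurrence (C := M * ∑ l ∈ Finset.range j, A l) hKr hK0 fun n => ?_
    rw [Function.iterate_succ_apply']
    refine (hM _ (hb.iterate_step hμ n)).trans ?_
    rw [mul_assoc, Finset.sum_mul]
    gcongr with l hl
    exact hA l (Finset.mem_range.1 hl) n

lemma pow_mul_norm_iterate_step_le {μ : Plane → ℂ} (hμ : SmoothPer μ) {K r : ℝ}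
    (hK : ∀ x, ‖μ x‖ ≤ K) (hKr : K < r) {b : (Fin 2 → ℤ) → ℂ} (hb : Rapid b) (j : ℕ) :
    ∃ A, ∀ n k, (1 + ‖k‖) ^ j * ‖((step μ)^[n] b) k‖ ≤ A * r ^ n := by
  obtain ⟨A, -, hA⟩ := nrm_iterate_dcoef_iterate_step_le hμ hK hKr hb 0 0
  obtain ⟨A0, -, hA0⟩ := nrm_iterate_dcoef_iterate_step_le hμ hK hKr hb 0 j
  obtain ⟨A1, -, hA1⟩ := nrm_iterate_dcoef_iterate_step_le hμ hK hKr hb 1 j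
  refine ⟨2 ^ j * (A + A0 + A1), fun n k => (pow_mul_norm_le _ j k).trans ?_⟩
  have hr := hb.iterate_step hμ n
  have e := (norm_le_nrm hr k).trans (hA n)
  have e0 := (norm_le_nrm (hr.iterate_dcoef 0 j) k).trans (hA0 n)
  have e1 := (norm_le_nrm (hr.iterate_dcoef 1 j) k).trans (hA1 n)
  calc _ ≤ 2 ^ j * (A * r ^ n + A0 * r ^ n + A1 * r ^ n) := by gcongr
    _ = _ := by ring

/-- The bound makes the double series over `n` and `k` absolutely convergent, so the two summations
may be exchanged. -/
lemma hasSum_synth {v : ℕ → (Fin 2 → ℤ) → ℂ} {w : (Fin 2 → ℤ) → ℂ} {C r : ℝ} (hr0 : 0 ≤ r)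
    (hr : r < 1) (hC : ∀ n k, (1 + ‖k‖) ^ 3 * ‖v n k‖ ≤ C * r ^ n)
    (hw : ∀ k, HasSum (fun n => v n k) (w k)) (x : Plane) :
    HasSum (fun n => synth (v n) x) (synth w x) := by
  have hs : Summable fun p : ℕ × (Fin 2 → ℤ) => v p.1 p.2 * chr p.2 x := by
    refine .of_norm_bounded (g := fun p : ℕ × (Fin 2 → ℤ) => r ^ p.1 * (C * ((1 + ‖p.2‖) ^ 3)⁻¹))
      ?_ fun p => ?_
    · have h1 : Summable fun n : ℕ => ‖r ^ n‖ := by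
        simpa [abs_of_nonneg hr0] using summable_geometric_of_lt_one hr0 hr
      have h2 : Summable fun k : Fin 2 → ℤ => ‖C * ((1 + ‖k‖) ^ 3)⁻¹‖ :=
        (summable_one_add_norm_inv.mul_left C).norm
      exact summable_mul_of_summable_norm h1 h2
    · rw [norm_mul, norm_chr, mul_one, mul_left_comm, ← mul_assoc, ← div_eq_mul_inv,
        le_div_iff₀ (by positivity), mul_comm]
      exact hC p.1 p.2
  have h1 := hs.prod_symm.hasSum.prod_fiberwise fun k => (hw k).mul_right (chr k x)
  have h2 := hs.hasSum.prod_fiberwise fun n => (hs.prod_factor n).hasSum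
  have e : ∑' p : (Fin 2 → ℤ) × ℕ, v p.swap.1 p.swap.2 * chr p.swap.2 x =
      ∑' p : ℕ × (Fin 2 → ℤ), v p.1 p.2 * chr p.2 x :=
    (Equiv.prodComm (Fin 2 → ℤ) ℕ).tsum_eq fun p : ℕ × (Fin 2 → ℤ) => v p.1 p.2 * chr p.2 x
  rw [synth, h1.tsum_eq, e]
  exact h2

/-- Solvability of the inhomogeneous Beltrami equation on the torus in terms of `w = ∂̄ σ`. -/
lemma exists_rapid_solution {μ h : Plane → ℂ} (hμ : SmoothPer μ) (hh : SmoothPer h)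
    (hlt : ∀ x, ‖μ x‖ < 1) :
    ∃ w, Rapid w ∧ ∀ x, synth w x = μ x * synth (beur w) x + h x := by
  -- By compactness `‖μ‖` attains its supremum, which leaves room for a rate `r` strictly between it
  -- and 1.
  obtain ⟨x₀, hx₀⟩ := (hμ.periodic.comp fun z => ‖z‖).exists_bound hμ.smooth.continuous.norm
  obtain ⟨r, hr1, hr2⟩ := exists_between (hlt x₀)
  have hr0 : 0 ≤ r := (norm_nonneg _).trans hr1.le
  have hb := hh.rapid
  set v : ℕ → (Fin 2 → ℤ) → ℂ := fun n => (step μ)^[n] (coef h) with hv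
  have hbd := pow_mul_norm_iterate_step_le hμ hx₀ hr1 hb
  have hsum : ∀ k, HasSum (fun n => v n k) (∑' n, v n k) := by
    intro k
    obtain ⟨A, hA⟩ := hbd 0
    refine Summable.hasSum (.of_norm_bounded
      ((summable_geometric_of_lt_one hr0 hr2).mul_left A) fun n => ?_)
    simpa using hA n k
  set w : (Fin 2 → ℤ) → ℂ := fun k => ∑' n, v n k with hw
  have hrw : Rapid w := by
    intro j
    obtain ⟨A, hA⟩ := hbd j
    refine ⟨A * (1 - r)⁻¹, fun k => ?_⟩
    have hg := (hasSum_geometric_of_lt_one hr0 hr2).mul_left (A * ((1 + ‖k‖) ^ j)⁻¹)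
    have h1 := tsum_of_norm_bounded hg fun n => by
      rw [mul_right_comm, ← div_eq_mul_inv, le_div_iff₀ (by positivity), mul_comm]
      exact hA n k
    calc (1 + ‖k‖) ^ j * ‖w k‖ ≤ (1 + ‖k‖) ^ j * (A * ((1 + ‖k‖) ^ j)⁻¹ * (1 - r)⁻¹) := by
          gcongr
      _ = _ := by field_simp
  obtain ⟨A, hA⟩ := hbd 3
  refine ⟨w, hrw, fun x => ?_⟩
  have s1 := hasSum_synth hr0 hr2 hA hsum x
  have s2 := hasSum_synth (v := fun n => beur (v n)) hr0 hr2
    (fun n k => by simpa only [norm_beur] using hA n k) (hasSum_beur hsum) x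
  -- Applying `step μ` shifts the Neumann series by one, so the image of `w` is `w` without its
  -- initial term `h`.
  have s3 : HasSum (fun n => synth (v (n + 1)) x) (μ x * synth (beur w) x) := by
    refine (s2.mul_left (μ x)).congr_fun fun n => ?_
    simp only [hv, Function.iterate_succ_apply']
    exact congrFun ((hb.iterate_step hμ n).smoothPer_mul hμ).synth_coef x
  have s4 := (hasSum_nat_add_iff' 1).2 s1
  have s5 := s3.unique s4
  simp only [Finset.range_one, Finset.sum_singleton, Function.iterate_zero, id_eq,
    hh.synth_coef] at s5
  rw [s5]
  exact (sub_add_cancel _ _).symm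

end FrameEnergy

end

noncomputable section

open MeasureTheory Set ComplexConjugate

namespace FrameEnergy

/-! ### The closed one-form of an isothermal coordinate -/

lemma synth_eq_add {a : (Fin 2 → ℤ) → ℂ} (ha : Rapid a) (x : Plane) :
    synth a x = a 0 + synth (fun k => if k = 0 then 0 else a k) x := by
  have hs : Summable fun k => a k * chr k x :=
    .of_norm (by simpa [norm_chr] using ha.summable_norm)
  rw [synth, hs.tsum_eq_add_tsum_ite 0, synth]
  congr 1
  · simp [chr]
  · refine tsum_congr fun k => ?_
    by_cases hk : k = 0 <;> simp [hk]

lemma synth_add {a b : (Fin 2 → ℤ) → ℂ} (ha : Rapid a) (hb : Rapid b) (x : Plane) :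
    synth (fun k => a k + b k) x = synth a x + synth b x := by
  have hs : ∀ {a : (Fin 2 → ℤ) → ℂ}, Rapid a → Summable fun k => a k * chr k x :=
    fun ha => .of_norm (by simpa [norm_chr] using ha.summable_norm)
  rw [synth, synth, synth, ← (hs ha).tsum_add (hs hb)]
  exact tsum_congr fun k => add_mul _ _ _

lemma synth_mul_left (c : ℂ) (a : (Fin 2 → ℤ) → ℂ) (x : Plane) :
    synth (fun k => c * a k) x = c * synth a x := by
  rw [synth, synth, ← tsum_mul_left]
  exact tsum_congr fun k => mul_assoc _ _ _

lemma Rapid.const_mul {a : (Fin 2 → ℤ) → ℂ} (ha : Rapid a) (c : ℂ) : Rapid fun k => c * a k := by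
  intro j
  obtain ⟨C, hC⟩ := ha j
  refine ⟨‖c‖ * C, fun k => ?_⟩
  rw [norm_mul, mul_left_comm]
  gcongr
  exact hC k

lemma one_le_norm_int_add {k : Fin 2 → ℤ} (hk : k ≠ 0) : 1 ≤ ‖(k 0 : ℂ) + Complex.I * k 1‖ := by
  have h : 1 ≤ |k 0| ∨ 1 ≤ |k 1| := by
    by_contra! h
    apply hk
    ext i
    fin_cases i
    · exact Int.abs_lt_one_iff.1 h.1
    · exact Int.abs_lt_one_iff.1 h.2
  rcases h with h | h
  · refine le_trans ?_ (Complex.abs_re_le_norm _)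
    simpa using (by exact_mod_cast h : (1 : ℝ) ≤ |(k 0 : ℝ)|)
  · refine le_trans ?_ (Complex.abs_im_le_norm _)
    simpa using (by exact_mod_cast h : (1 : ℝ) ≤ |(k 1 : ℝ)|)

/-- Fourier coefficients of the periodic part of the `∂̄`-primitive. -/
def primCoef (w : (Fin 2 → ℤ) → ℂ) (k : Fin 2 → ℤ) : ℂ :=
  if k = 0 then 0 else w k / (Real.pi * Complex.I * (k 0 + Complex.I * k 1))

lemma rapid_primCoef {w : (Fin 2 → ℤ) → ℂ} (hw : Rapid w) : Rapid (primCoef w) := by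
  refine hw.of_le fun k => ?_
  by_cases hk : k = 0
  · simp [primCoef, hk]
  · rw [primCoef, if_neg hk, norm_div]
    refine div_le_self (norm_nonneg _) ?_
    have h1 := one_le_norm_int_add hk
    have h2 : (1 : ℝ) ≤ ‖(Real.pi * Complex.I : ℂ)‖ := by
      simp [abs_of_pos Real.pi_pos]; linarith [Real.pi_gt_three]
    rw [norm_mul]
    nlinarith

lemma dcoef_zero_primCoef (w : (Fin 2 → ℤ) → ℂ) :
    dcoef 0 (primCoef w) = fun k => if k = 0 then 0 else beur w k + w k := by
  ext k
  by_cases hk : k = 0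
  · simp [dcoef, primCoef, hk]
  · have h := int_add_I_mul_int_ne_zero hk
    have hpi : (Real.pi : ℂ) ≠ 0 := by exact_mod_cast Real.pi_ne_zero
    simp only [dcoef, primCoef, hk, if_false, beur, dsym]
    field_simp [Complex.I_ne_zero]
    ring

lemma dcoef_one_primCoef (w : (Fin 2 → ℤ) → ℂ) :
    dcoef 1 (primCoef w) =
      fun k => if k = 0 then 0 else Complex.I * (beur w k + (-1) * w k) := by
  ext k
  by_cases hk : k = 0
  · simp [dcoef, primCoef, hk]
  · have h := int_add_I_mul_int_ne_zero hk
    have hpi : (Real.pi : ℂ) ≠ 0 := by exact_mod_cast Real.pi_ne_zero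
    simp only [dcoef, primCoef, hk, if_false, beur, dsym]
    field_simp [Complex.I_ne_zero]
    ring_nf
    simp only [Complex.I_sq]
    ring

/-- Every `w` is `∂̄ σ` for a function `σ` that is periodic up to additive imaginary constants. -/
lemma exists_primitive {w : (Fin 2 → ℤ) → ℂ} (hw : Rapid w) :
    ∃ σ : Plane → ℂ, ContDiff ℝ ∞ σ ∧
      (∀ x, HasFDerivAt σ (covec (synth (beur w) x + synth w x)
        (Complex.I * (synth (beur w) x - synth w x))) x) ∧
      ∀ k : Fin 2 → ℤ, ∃ s : ℂ, s.re = 0 ∧ ∀ x, σ (x + fun i => (k i : ℝ)) = σ x + s := by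
  -- The zero modes integrate to the linear function `α z + w₀ z̄` with `α = -conj w₀`, which is
  -- purely imaginary. This is the reason for the value of `beur` at `k = 0`.
  set α : ℂ := beur w 0 with hα
  have hα' : α = -conj (w 0) := by simp [hα, beur]
  have hp := rapid_primCoef hw
  set L : Plane →L[ℝ] ℂ := covec (α + w 0) (Complex.I * (α - w 0)) with hL
  refine ⟨fun x => L x + synth (primCoef w) x, L.contDiff.add (contDiff_synth hp), fun x => ?_,
    fun k => ⟨L fun i => (k i : ℝ), ?_, fun x => ?_⟩⟩
  · refine (L.hasFDerivAt.add (hasFDerivAt_synth hp x)).congr_fderiv ?_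
    have e0 : synth (beur w) x + synth w x = α + w 0 + synth (dcoef 0 (primCoef w)) x := by
      rw [← synth_add hw.beur hw, synth_eq_add (a := fun k => beur w k + w k) (hw.beur.add hw), dcoef_zero_primCoef]
    have e1 : Complex.I * (synth (beur w) x - synth w x) =
        Complex.I * (α - w 0) + synth (dcoef 1 (primCoef w)) x := by
      have h2 := hw.const_mul (-1)
      rw [sub_eq_add_neg, ← neg_one_mul (synth w x), ← synth_mul_left, ← synth_add hw.beur h2,
        ← synth_mul_left, synth_eq_add (a := fun k => Complex.I * (beur w k + -1 * w k))
        ((hw.beur.add h2).const_mul _), dcoef_one_primCoef]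
      congr 1
      simp only [hα]
      ring
    rw [e0, e1]
    ext v
    simp only [hL, _root_.add_apply, covec_apply]
    ring
  · rw [hL, covec_apply, hα']
    simp
  · have hper := torusPeriodic_synth (primCoef w) _ _ (sameTorusPoint_add_int x k)
    simp only [hper, map_add]
    ring

/-- The Poincaré lemma on the plane: the hypothesis says that `P dx₁ + Q dx₂` is closed. -/
lemma exists_primitive_covec {P Q : Plane → ℂ} (hP : ContDiff ℝ ∞ P) (hQ : ContDiff ℝ ∞ Q)
    (h : ∀ x, fderiv ℝ P x (Pi.single 1 1) = fderiv ℝ Q x (Pi.single 0 1)) :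
    ∃ F : Plane → ℂ, ContDiff ℝ ∞ F ∧ ∀ x, HasFDerivAt F (covec (P x) (Q x)) x := by
  have hω : ContDiff ℝ ∞ fun x => covec (P x) (Q x) := contDiff_covec hP hQ
  have hd : ∀ x v u, fderiv ℝ (fun x => covec (P x) (Q x)) x v u =
      u 0 * fderiv ℝ P x v + u 1 * fderiv ℝ Q x v := by
    intro x v u
    have h1 : HasFDerivAt (fun x => covec (P x) (Q x) u) _ x :=
      ((hω.differentiable (by simp)) x).hasFDerivAt.clm_apply (hasFDerivAt_const u x)
    have h2 : HasFDerivAt (fun x => (u 0 : ℂ) * P x + (u 1 : ℂ) * Q x)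
        ((u 0 : ℂ) • fderiv ℝ P x + (u 1 : ℂ) • fderiv ℝ Q x) x :=
      (((hP.differentiable (by simp)) x).hasFDerivAt.const_mul _).add
        (((hQ.differentiable (by simp)) x).hasFDerivAt.const_mul _)
    have e : (fun x => covec (P x) (Q x) u) = fun x => (u 0 : ℂ) * P x + (u 1 : ℂ) * Q x :=
      funext fun x => covec_apply _ _ _
    rw [e] at h1
    have := congrArg (fun T : Plane →L[ℝ] ℂ => T v) (h1.unique h2)
    simpa using this
  obtain ⟨F, hF⟩ := convex_univ.exists_forall_hasFDerivAt_of_fderiv_symmetric isOpen_univ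
    (hω.differentiable (by simp)).differentiableOn fun x _ v u => by
      rw [hd, hd]
      rw [eq_covec (fderiv ℝ P x), eq_covec (fderiv ℝ Q x), h x]
      simp only [covec_apply]
      ring
  refine ⟨F, ?_, fun x => hF x trivial⟩
  have : fderiv ℝ F = fun x => covec (P x) (Q x) := funext fun x => (hF x trivial).fderiv
  rw [contDiff_infty_iff_fderiv]
  exact ⟨fun x => (hF x trivial).differentiableAt, this ▸ hω⟩

/-- A global isothermal coordinate, up to holonomy, for the conformal structure given by the
Beltrami coefficient `μ`. -/
lemma exists_beltrami_solution {μ : Plane → ℂ} (hμ : SmoothPer μ) (hlt : ∀ x, ‖μ x‖ < 1) :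
    ∃ ψ F : Plane → ℂ, Continuous ψ ∧ (∀ x, ψ x ≠ 0) ∧ ContDiff ℝ ∞ F ∧
      (∀ x, HasFDerivAt F (covec (ψ x * (1 + μ x)) (ψ x * (Complex.I * (1 - μ x)))) x) ∧
      ∀ k : Fin 2 → ℤ, ∃ χ : ℂ, ‖χ‖ = 1 ∧ ∀ x, ψ (x + fun i => (k i : ℝ)) = χ * ψ x := by
  have hm : ∀ i, SmoothPer fun x => fderiv ℝ μ x (Pi.single i 1) := hμ.fderiv
  -- The inhomogeneity is `∂μ`, with `∂ = (∂₁ - i∂₂)/2`.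
  obtain ⟨w, hw, hweq⟩ := exists_rapid_solution
    (h := fun x => 1 / 2 * (fderiv ℝ μ x (Pi.single 0 1) -
      Complex.I * fderiv ℝ μ x (Pi.single 1 1))) hμ
    ⟨contDiff_const.mul ((hm 0).smooth.sub (contDiff_const.mul (hm 1).smooth)),
      (hm 0).periodic.comp₂ (hm 1).periodic fun a b => 1 / 2 * (a - Complex.I * b)⟩ hlt
  obtain ⟨σ, hσ, hσd, hσp⟩ := exists_primitive hw
  have hP : ContDiff ℝ ∞ fun x => Complex.exp (σ x) * (1 + μ x) :=
    hσ.cexp.mul (contDiff_const.add hμ.smooth)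
  have hQ : ContDiff ℝ ∞ fun x => Complex.exp (σ x) * (Complex.I * (1 - μ x)) :=
    hσ.cexp.mul (contDiff_const.mul (contDiff_const.sub hμ.smooth))
  -- The form is `e^σ (dz + μ dz̄)`; its closedness is exactly `∂̄σ = μ ∂σ + ∂μ`, supplied by
  -- `hweq`.
  obtain ⟨F, hF, hFd⟩ := exists_primitive_covec hP hQ fun x => by
    have hμd := (hμ.smooth.differentiable (by simp) x).hasFDerivAt
    have h1 : HasFDerivAt (fun x => Complex.exp (σ x) * (1 + μ x)) _ x :=
      (hσd x).cexp.mul (hμd.const_add 1)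
    have h2 : HasFDerivAt (fun x => Complex.exp (σ x) * (Complex.I * (1 - μ x))) _ x :=
      (hσd x).cexp.mul ((hμd.const_sub 1).const_mul Complex.I)
    rw [h1.fderiv, h2.fderiv]
    simp only [_root_.add_apply, _root_.smul_apply, _root_.neg_apply, smul_eq_mul, covec_single_one,
      covec_single_zero]
    rw [hweq x]
    ring_nf
    simp only [Complex.I_sq]
    ring
  refine ⟨fun x => Complex.exp (σ x), F, hσ.continuous.cexp, fun x => Complex.exp_ne_zero _, hF,
    hFd, fun k => ?_⟩
  obtain ⟨s, hs, hk⟩ := hσp k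
  refine ⟨Complex.exp s, by rw [Complex.norm_exp, hs, Real.exp_zero], fun x => ?_⟩
  simp only [hk, Complex.exp_add, mul_comm]

end FrameEnergy

end

noncomputable section

open MeasureTheory Set ComplexConjugate Metric Topology

namespace FrameEnergy

/-! ### Local homeomorphisms with sections over balls of a fixed radius -/

section Covering

lemma isOpen_image_section {X V : Type*} [TopologicalSpace X] [TopologicalSpace V] {F : X → V}
    (hF : IsLocalHomeomorph F) {g : V → X} {W : Set V} (hW : IsOpen W)
    (hg : ContinuousOn g W) (hgF : ∀ z ∈ W, F (g z) = z) : IsOpen (g '' W) := by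
  rw [isOpen_iff_mem_nhds]
  rintro _ ⟨z, hz, rfl⟩
  obtain ⟨φ, hφ, rfl⟩ := hF (g z)
  have h1 : ∀ᶠ z' in 𝓝 (φ (g z)), z' ∈ W ∧ g z' ∈ φ.source := by
    rw [hgF z hz]
    exact (hW.eventually_mem hz).and
      ((hg.continuousAt (hW.mem_nhds hz)).preimage_mem_nhds (φ.open_source.mem_nhds hφ))
  filter_upwards [(φ.continuousAt hφ).eventually h1, φ.open_source.mem_nhds hφ] with x hx hxs
  exact ⟨φ x, hx.1, φ.injOn hx.2 hxs (hgF _ hx.1)⟩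

variable {X V : Type*} [TopologicalSpace X] [T2Space X] [NormedAddCommGroup V] [NormedSpace ℝ V]
  {F : X → V}

/-- Sections over balls of a uniform radius rule out the escape of sheets: over a half-radius ball
around `y`, the sheets are the images of the sections through the points of the fibre over `y`. -/
lemma isCoveringMap_of_sections (hF : IsLocalHomeomorph F) {r : ℝ} (hr : 0 < r)
    (h : ∀ x, ∃ g : V → X, ContinuousOn g (ball (F x) r) ∧ g (F x) = x ∧
      ∀ z ∈ ball (F x) r, F (g z) = z) : IsCoveringMap F := by
  choose g hgc hgx hgF using h
  -- Unique continuation: balls are connected and `F` is locally injective with Hausdorff source.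
  have key : ∀ x x' z₀ s, s ≤ r → ∀ y, ball y s ⊆ ball (F x) r → ball y s ⊆ ball (F x') r →
      z₀ ∈ ball y s → g x z₀ = g x' z₀ → EqOn (g x) (g x') (ball y s) := by
    intro x x' z₀ s _ y h1 h2 hz h0
    refine (T2Space.isSeparatedMap F).eqOn_of_comp_eqOn hF.isLocallyInjective
      (convex_ball y s).isPreconnected ((hgc x).mono h1) ((hgc x').mono h2) ?_ hz h0
    intro z hz
    simp only [Function.comp_apply, hgF x z (h1 hz), hgF x' z (h2 hz)]
  intro y
  have hdisc : DiscreteTopology (F ⁻¹' {y}) :=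
    (IsDiscrete.of_openPartialHomeomorph F subset_rfl fun e _ => by
      obtain ⟨φ, hφ, h⟩ := hF e; exact ⟨φ, hφ, h.symm⟩).1
  rcases isEmpty_or_nonempty (F ⁻¹' {y}) with hem | hne
  · refine .of_preimage_eq_empty (F ⁻¹' {y}) (ball_mem_nhds y hr) ?_
    rw [eq_empty_iff_forall_notMem]
    intro x hx
    exact hem.false ⟨g x y, hgF x y (mem_ball_comm.1 hx)⟩
  have hX : Nonempty X := ⟨(Classical.arbitrary (F ⁻¹' {y}) : F ⁻¹' {y})⟩
  -- With half the radius, the section through any point lying over `B` is defined on all of `B`,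
  -- hence reaches the fibre over `y`.
  set B := ball y (r / 2) with hB
  have hBp : ∀ p : F ⁻¹' {y}, B ⊆ ball (F p) r := fun p => by
    rw [show F p = y from p.2]; exact ball_subset_ball (by linarith)
  have hU : ∀ p : F ⁻¹' {y}, ∀ W ⊆ B, F ⁻¹' W ∩ g p '' B = g p '' W := by
    intro p W hW
    ext x
    constructor
    · rintro ⟨hx, z, hz, rfl⟩
      rw [mem_preimage, hgF _ _ (hBp p hz)] at hx
      exact ⟨z, hx, rfl⟩
    · rintro ⟨z, hz, rfl⟩
      exact ⟨by rwa [mem_preimage, hgF _ _ (hBp p (hW hz))], z, hW hz, rfl⟩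
  refine .of_trivialization (t := isOpen_ball.trivializationDiscrete (fun p : F ⁻¹' {y} => g p '' B) B
    (fun p W hW => ?_) (fun p => ?_) (fun p z hz => ⟨g p z, ⟨z, hz, rfl⟩, hgF _ _ (hBp p hz)⟩)
    (fun p q hpq => ?_) (fun x hx => ?_)) (mem_ball_self (half_pos hr))
  · rw [hU p W hW]
    refine ⟨fun hWo => isOpen_image_section hF hWo ((hgc p).mono (hW.trans (hBp p)))
      fun z hz => hgF _ _ (hBp p (hW hz)), fun ho => ?_⟩
    have : F '' (g p '' W) = W := by
      rw [image_image]
      exact (image_congr fun z hz => hgF _ _ (hBp p (hW hz))).trans (image_id' W)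
    rw [← this]
    exact hF.isOpenMap _ ho
  · rintro _ ⟨z, hz, rfl⟩ _ ⟨z', hz', rfl⟩ he
    rw [hgF _ _ (hBp p hz), hgF _ _ (hBp p hz')] at he
    rw [he]
  · refine Set.disjoint_left.2 ?_
    rintro _ ⟨z, hz, rfl⟩ ⟨z', hz', he⟩
    have hzz : z' = z := by rw [← hgF q z' (hBp q hz'), he, hgF p z (hBp p hz)]
    subst hzz
    have h1 := key q p z' (r / 2) (by linarith) y (hBp q) (hBp p) hz he
      (mem_ball_self (half_pos hr))
    apply hpq
    have hp := hgx p
    have hq := hgx q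
    rw [show F p = y from p.2] at hp
    rw [show F q = y from q.2] at hq
    exact Subtype.ext (hp.symm.trans (h1.symm.trans hq))
  · have hx' : dist (F x) y < r / 2 := hx
    have hBx : B ⊆ ball (F x) r := ball_subset_ball' (by rw [dist_comm]; linarith)
    have hyx : y ∈ B := mem_ball_self (half_pos hr)
    set p : F ⁻¹' {y} := ⟨g x y, hgF x y (hBx hyx)⟩
    have hp : g p y = p := by
      have := hgx p
      rwa [show F p = y from p.2] at this
    have h1 := key p x y (r / 2) (by linarith) y (hBp p) hBx hyx hp
    exact mem_iUnion.2 ⟨p, F x, hx, (h1 hx).trans (hgx x)⟩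

/-- The base is simply connected, so the identity lifts to a global section `G`; then `G ∘ F` and
`id` lift the same map, agree at one point, and coincide because `X` is connected. -/
lemma bijective_of_sections [ConnectedSpace X] (hF : IsLocalHomeomorph F) {r : ℝ} (hr : 0 < r)
    (h : ∀ x, ∃ g : V → X, ContinuousOn g (ball (F x) r) ∧ g (F x) = x ∧
      ∀ z ∈ ball (F x) r, F (g z) = z) : Function.Bijective F := by
  have hc := isCoveringMap_of_sections hF hr h
  obtain ⟨x₀⟩ : Nonempty X := inferInstance
  obtain ⟨G, ⟨hG0, hG⟩, -⟩ := hc.existsUnique_continuousMap_lifts (ContinuousMap.id V) (F x₀) x₀ rfl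
  have hFG : ∀ z, F (G z) = z := fun z => congrFun hG z
  have hGF : G ∘ F = id := hc.eq_of_comp_eq (G.continuous.comp hc.continuous) continuous_id
    (funext fun x => hFG (F x)) x₀ hG0
  have hGF' : Function.LeftInverse G F := fun x => congrFun hGF x
  exact ⟨hGF'.injective, fun z => ⟨G z, hFG z⟩⟩

end Covering

/-! ### Developing maps of the torus -/

lemma exists_continuousLinearEquiv {L : Plane →L[ℝ] ℂ} (hL : Function.Injective L) :
    ∃ e : Plane ≃L[ℝ] ℂ, (e : Plane →L[ℝ] ℂ) = L := by
  have hf : Module.finrank ℝ Plane = Module.finrank ℝ ℂ := by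
    rw [Module.finrank_fin_fun, Complex.finrank_real_complex]
  exact ⟨(LinearEquiv.ofInjectiveOfFinrankEq L.toLinearMap hL hf).toContinuousLinearEquiv, by
    ext v; rfl⟩

lemma isLocalHomeomorph_of_injective_fderiv {F : Plane → ℂ} (hF : ContDiff ℝ ∞ F)
    (hinj : ∀ x, Function.Injective (fderiv ℝ F x)) : IsLocalHomeomorph F := by
  intro x
  obtain ⟨e, he⟩ := exists_continuousLinearEquiv (hinj x)
  have h : HasFDerivAt F (e : Plane →L[ℝ] ℂ) x :=
    he ▸ (hF.differentiable (by simp) x).hasFDerivAt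
  exact ⟨hF.contDiffAt.toOpenPartialHomeomorph F h (by simp),
    hF.contDiffAt.mem_toOpenPartialHomeomorph_source h (by simp), rfl⟩

/-- A local diffeomorphism from the plane that is equivariant under deck transformations with
respect to Euclidean motions is bijective. -/
lemma bijective_of_equivariant {F : Plane → ℂ} (hF : IsLocalHomeomorph F)
    (heq : ∀ k : Fin 2 → ℤ, ∃ χ c : ℂ, ‖χ‖ = 1 ∧ ∀ x, F (x + fun i => (k i : ℝ)) = χ * F x + c) :
    Function.Bijective F := by
  -- Compactness of the unit square gives one radius for all its points; since the motions are
  -- isometries, equivariance carries it to the whole plane.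
  have hloc : ∃ r : ℝ, 0 < r ∧ ∀ x ∈ Icc (0 : Plane) 1, ∃ g : ℂ → Plane,
      ContinuousOn g (ball (F x) r) ∧ g (F x) = x ∧ ∀ z ∈ ball (F x) r, F (g z) = z := by
    refine (isCompact_Icc (a := (0 : Plane)) (b := 1)).induction_on
      (p := fun S => ∃ r : ℝ, 0 < r ∧ ∀ x ∈ S, ∃ g : ℂ → Plane,
        ContinuousOn g (ball (F x) r) ∧ g (F x) = x ∧ ∀ z ∈ ball (F x) r, F (g z) = z)
      ⟨1, one_pos, fun _ h => h.elim⟩ ?_ ?_ ?_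
    · rintro S T hST ⟨r, hr, h⟩
      exact ⟨r, hr, fun x hx => h x (hST hx)⟩
    · rintro S T ⟨r, hr, h⟩ ⟨r', hr', h'⟩
      refine ⟨min r r', lt_min hr hr', fun x hx => ?_⟩
      rcases hx with hx | hx
      · obtain ⟨g, h1, h2, h3⟩ := h x hx
        have hs := ball_subset_ball (x := F x) (min_le_left r r')
        exact ⟨g, h1.mono hs, h2, fun z hz => h3 z (hs hz)⟩
      · obtain ⟨g, h1, h2, h3⟩ := h' x hx
        have hs := ball_subset_ball (x := F x) (min_le_right r r')
        exact ⟨g, h1.mono hs, h2, fun z hz => h3 z (hs hz)⟩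
    · intro x _
      obtain ⟨φ, hφ, rfl⟩ := hF x
      obtain ⟨δ, hδ, hsub⟩ := Metric.isOpen_iff.1 φ.open_target (φ x) (φ.map_source hφ)
      refine ⟨φ.source ∩ φ ⁻¹' ball (φ x) (δ / 2), mem_nhdsWithin_of_mem_nhds
        (Filter.inter_mem (φ.open_source.mem_nhds hφ)
          ((φ.continuousAt hφ).preimage_mem_nhds (ball_mem_nhds _ (half_pos hδ)))),
        δ / 2, half_pos hδ, fun y hy => ⟨φ.symm, ?_⟩⟩
      have hy2 : dist (φ y) (φ x) < δ / 2 := hy.2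
      have hs : ball (φ y) (δ / 2) ⊆ φ.target :=
        (ball_subset_ball' (by linarith)).trans hsub
      exact ⟨φ.continuousOn_symm.mono hs, φ.left_inv hy.1, fun z hz => φ.right_inv (hs hz)⟩
  obtain ⟨r, hr, h⟩ := hloc
  refine bijective_of_sections hF hr fun x => ?_
  obtain ⟨y, hy, hxy⟩ := exists_sameTorusPoint_mem_Icc x
  obtain ⟨k, rfl⟩ := sameTorusPoint_iff.1 hxy
  obtain ⟨g, h1, h2, h3⟩ := h y hy
  obtain ⟨χ, c, hχ, hk⟩ := heq k
  have hχ0 : χ ≠ 0 := norm_ne_zero_iff.1 (by rw [hχ]; exact one_ne_zero)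
  have hmap : MapsTo (fun z => χ⁻¹ * (z - c)) (ball (F (y + fun i => (k i : ℝ))) r) (ball (F y) r) := by
    intro z hz
    rw [mem_ball, dist_eq_norm] at hz ⊢
    have : z - F (y + fun i => (k i : ℝ)) = χ * (χ⁻¹ * (z - c) - F y) := by
      rw [hk]; field_simp; ring
    rwa [this, norm_mul, hχ, one_mul] at hz
  refine ⟨fun z => g (χ⁻¹ * (z - c)) + fun i => (k i : ℝ), ?_, ?_, fun z hz => ?_⟩
  · exact (h1.comp (by fun_prop) hmap).add continuousOn_const
  · have : χ⁻¹ * (F (y + fun i => (k i : ℝ)) - c) = F y := by rw [hk]; field_simp; ring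
    simp only [this, h2]
  · rw [hk, h3 _ (hmap hz)]
    field_simp
    ring

end FrameEnergy

end

noncomputable section

open MeasureTheory Set ComplexConjugate Metric Topology

namespace FrameEnergy

/-! ### Uniformization of metrics on the torus -/

lemma covec_injective {P Q : ℂ} (h : 0 < (conj P * Q).im) : Function.Injective (covec P Q) := by
  rw [injective_iff_map_eq_zero]
  intro v hv
  rw [covec_apply] at hv
  have hr := congrArg Complex.re hv
  have hi := congrArg Complex.im hv
  simp only [Complex.add_re, Complex.mul_re, Complex.ofReal_re, Complex.ofReal_im, zero_mul,
    sub_zero, Complex.zero_re, Complex.add_im, Complex.mul_im, add_zero, Complex.zero_im,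
    Complex.conj_re, Complex.conj_im] at hr hi h
  have h0 : v 0 * (P.re * Q.im + -P.im * Q.re) = 0 := by linear_combination Q.im * hr - Q.re * hi
  have h1 : v 1 * (P.re * Q.im + -P.im * Q.re) = 0 := by linear_combination P.re * hi - P.im * hr
  ext i
  fin_cases i
  · exact (mul_eq_zero.1 h0).resolve_right h.ne'
  · exact (mul_eq_zero.1 h1).resolve_right h.ne'

lemma exists_smooth_inverse {F : Plane → ℂ} (hF : ContDiff ℝ ∞ F)
    (hinj : ∀ x, Function.Injective (fderiv ℝ F x)) (hb : Function.Bijective F) :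
    ∃ G : ℂ → Plane, ContDiff ℝ ∞ G ∧ (∀ x, G (F x) = x) ∧ ∀ z, F (G z) = z := by
  obtain ⟨G, hGF, hFG⟩ := Function.bijective_iff_has_inverse.1 hb
  refine ⟨G, contDiff_iff_contDiffAt.2 fun z => ?_, hGF, hFG⟩
  obtain ⟨e, he⟩ := exists_continuousLinearEquiv (hinj (G z))
  have h : HasFDerivAt F (e : Plane →L[ℝ] ℂ) (G z) :=
    he ▸ (hF.differentiable (by simp) (G z)).hasFDerivAt
  have h1 := hF.contDiffAt.to_localInverse h (by simp)
  rw [hFG] at h1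
  refine h1.congr_of_eventuallyEq ?_
  have hm := hF.contDiffAt.image_mem_toOpenPartialHomeomorph_target h (by simp)
  rw [hFG] at hm
  filter_upwards [(hF.contDiffAt.toOpenPartialHomeomorph F h (by simp)).open_target.mem_nhds hm]
    with y hy
  have h2 := (hF.contDiffAt.toOpenPartialHomeomorph F h (by simp)).right_inv hy
  exact hb.1 ((hFG y).trans h2.symm)

/-- A motion with `χ ≠ 1` fixes the point `c / (1 - χ)`; its preimage under `F` would be fixed by a
nonzero lattice translation. -/
lemma exists_translation {F : Plane → ℂ} (hb : Function.Bijective F)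
    (heq : ∀ k : Fin 2 → ℤ, ∃ χ c : ℂ, ‖χ‖ = 1 ∧ ∀ x, F (x + fun i => (k i : ℝ)) = χ * F x + c) :
    ∃ c : (Fin 2 → ℤ) →+ ℂ, ∀ k x, F (x + fun i => (k i : ℝ)) = F x + c k := by
  have h : ∀ k : Fin 2 → ℤ, ∃ c : ℂ, ∀ x, F (x + fun i => (k i : ℝ)) = F x + c := by
    intro k
    by_cases hk : k = 0
    · refine ⟨0, fun x => ?_⟩
      have : (x + fun i => (k i : ℝ)) = x := by ext i; simp [hk]
      rw [this, add_zero]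
    obtain ⟨χ, c, -, h⟩ := heq k
    by_cases hχ : χ = 1
    · exact ⟨c, fun x => by rw [h, hχ, one_mul]⟩
    · exfalso
      have h1 : 1 - χ ≠ 0 := sub_ne_zero.2 (Ne.symm hχ)
      obtain ⟨x, hx⟩ := hb.2 (c / (1 - χ))
      have h2 : F (x + fun i => (k i : ℝ)) = F x := by
        rw [h, hx]; field_simp; ring
      have h3 := hb.1 h2
      apply hk
      ext i
      simpa using congrFun h3 i
  choose c hc using h
  refine ⟨AddMonoidHom.mk' c fun k l => ?_, fun k x => hc k x⟩
  have h1 := hc (k + l) 0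
  have h2 := hc k (0 + fun i => (l i : ℝ))
  rw [hc l 0] at h2
  have : ((0 : Plane) + fun i => (l i : ℝ)) + (fun i => (k i : ℝ)) =
      0 + fun i => (((k + l) i : ℤ) : ℝ) := by
    ext i; simp [add_comm]
  rw [this, h1] at h2
  linear_combination h2

/-- If the periods were real-dependent, some nonzero real linear functional would vanish on them;
composed with `F` it would be periodic, hence bounded above, contradicting surjectivity. -/
lemma periods_independent {F : Plane → ℂ} (hF : Continuous F) (hb : Function.Surjective F)
    {c : (Fin 2 → ℤ) →+ ℂ} (hc : ∀ k x, F (x + fun i => (k i : ℝ)) = F x + c k)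
    {ω₁ ω₂ : ℂ} (hω : ∀ k, c k = k 0 * ω₁ + k 1 * ω₂) : (conj ω₁ * ω₂).im ≠ 0 := by
  intro h0
  obtain ⟨u, hu, h1, h2⟩ : ∃ u : ℂ, u ≠ 0 ∧ (conj u * ω₁).im = 0 ∧ (conj u * ω₂).im = 0 := by
    by_cases h1 : ω₁ = 0
    · by_cases h2 : ω₂ = 0
      · exact ⟨1, one_ne_zero, by simp [h1], by simp [h2]⟩
      · exact ⟨ω₂, h2, by simp [h1], by simp; ring⟩
    · exact ⟨ω₁, h1, by simp; ring, h0⟩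
  have hper : TorusPeriodic fun x => (conj u * F x).im := by
    intro x y hxy
    obtain ⟨k, rfl⟩ := sameTorusPoint_iff.1 hxy
    have : conj u * (F y + (k 0 * ω₁ + k 1 * ω₂)) =
        conj u * F y + ((k 0 : ℝ) * (conj u * ω₁) + (k 1 : ℝ) * (conj u * ω₂)) := by
      push_cast; ring
    simp only [hc, hω, this, Complex.add_im, Complex.im_ofReal_mul, h1, h2]
    ring
  obtain ⟨x₀, hx₀⟩ := hper.exists_bound (Complex.continuous_im.comp (continuous_const.mul hF))
  set M := (conj u * F x₀).im
  have hn : 0 < Complex.normSq u := Complex.normSq_pos.2 hu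
  obtain ⟨x, hx⟩ := hb (u * (((M + 1) / Complex.normSq u : ℝ) * Complex.I))
  have h3 := hx₀ x
  have h4 : (conj u * F x).im = M + 1 := by
    rw [hx, ← mul_assoc, ← Complex.normSq_eq_conj_mul_self, Complex.im_ofReal_mul,
      Complex.im_ofReal_mul, Complex.I_im, mul_one, mul_div_cancel₀ _ hn.ne']
  linarith

lemma exists_conformalDiffeo_of_developing {g : Plane → Matrix (Fin 2) (Fin 2) ℝ}
    {F P Q : Plane → ℂ} (hF : ContDiff ℝ ∞ F) (hd : ∀ x, HasFDerivAt F (covec (P x) (Q x)) x)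
    (hpos : ∀ x, 0 < (conj (P x) * Q x).im)
    (hconf : ∀ x, ∃ κ : ℝ, 0 < κ ∧ ∀ v u : Plane, v ⬝ᵥ (g x).mulVec u =
      κ * inner ℝ (covec (P x) (Q x) v) (covec (P x) (Q x) u))
    (heq : ∀ k : Fin 2 → ℤ, ∃ χ c : ℂ, ‖χ‖ = 1 ∧ ∀ x, F (x + fun i => (k i : ℝ)) = χ * F x + c) :
    ∃ (τ : ℍ) (Ψ : ℂ → Plane), IsConformalDiffeo τ g Ψ := by
  have hinj : ∀ x, Function.Injective (fderiv ℝ F x) := fun x => by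
    rw [(hd x).fderiv]; exact covec_injective (hpos x)
  have hb := bijective_of_equivariant (isLocalHomeomorph_of_injective_fderiv hF hinj) heq
  obtain ⟨G, hG, hGF, hFG⟩ := exists_smooth_inverse hF hinj hb
  obtain ⟨c, hc⟩ := exists_translation hb heq
  set ω₁ := c (Pi.single 0 1) with hω₁
  set ω₂ := c (Pi.single 1 1) with hω₂
  have hω : ∀ k, c k = k 0 * ω₁ + k 1 * ω₂ := by
    intro k
    have : k = k 0 • Pi.single 0 1 + k 1 • Pi.single 1 1 := by
      ext i; fin_cases i <;> simp
    conv_lhs => rw [this]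
    rw [map_add, map_zsmul, map_zsmul, zsmul_eq_mul, zsmul_eq_mul]
  have hind := periods_independent hF.continuous hb.2 hc hω
  have hω0 : ω₁ ≠ 0 := fun h => hind (by simp [h])
  have hn : 0 < Complex.normSq ω₁ := Complex.normSq_pos.2 hω0
  have him : (ω₂ / ω₁).im ≠ 0 := by
    have : ω₂ / ω₁ = ((Complex.normSq ω₁)⁻¹ : ℝ) * (conj ω₁ * ω₂) := by
      push_cast
      rw [Complex.normSq_eq_conj_mul_self]
      have : conj ω₁ ≠ 0 := (map_ne_zero _).2 hω0
      field_simp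
    rw [this, Complex.im_ofReal_mul]
    exact mul_ne_zero (inv_ne_zero hn.ne') hind
  -- Replacing `ω₂` by `-ω₂` leaves the lattice unchanged, so the sign of the period ratio need not
  -- be determined; the orientation of `Ψ` is checked pointwise below.
  obtain ⟨τ, ε, hε, hτ⟩ : ∃ (τ : ℍ) (ε : ℤ), ε * ε = 1 ∧ (τ : ℂ) * ω₁ = ε * ω₂ := by
    rcases lt_or_gt_of_ne him with h | h
    · exact ⟨⟨-(ω₂ / ω₁), by simpa using h⟩, -1, by norm_num, by
        change -(ω₂ / ω₁) * ω₁ = _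
        field_simp
        push_cast
        ring⟩
    · exact ⟨⟨ω₂ / ω₁, h⟩, 1, by norm_num, by
        change (ω₂ / ω₁) * ω₁ = _
        field_simp
        push_cast
        ring⟩
  have hε' : (ε : ℂ) * ε = 1 := by exact_mod_cast hε
  set Ψ : ℂ → Plane := fun z => G (ω₁ * z) with hΨ
  have hΨs : ContDiff ℝ ∞ Ψ := hG.comp (contDiff_const.mul contDiff_id)
  have hFΨ : ∀ z, F (Ψ z) = ω₁ * z := fun z => hFG _
  have hdΨ : ∀ z v, covec (P (Ψ z)) (Q (Ψ z)) (fderiv ℝ Ψ z v) = ω₁ * v := by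
    intro z v
    have h1 : HasFDerivAt (fun z => F (Ψ z)) _ z :=
      (hd (Ψ z)).comp z (hΨs.differentiable (by simp) z).hasFDerivAt
    simp only [hFΨ] at h1
    have h2 : HasFDerivAt (fun z : ℂ => ω₁ * z) (ω₁ • ContinuousLinearMap.id ℝ ℂ) z :=
      (hasFDerivAt_id z).const_mul ω₁
    exact congrArg (fun T : ℂ →L[ℝ] ℂ => T v) (h1.unique h2)
  refine ⟨τ, Ψ, hΨs, fun z w => ?_, fun x => ?_, fun z => ?_, fun z => ?_⟩
  · have hk : ∀ k : Fin 2 → ℤ, (Ψ z = Ψ w + fun i => (k i : ℝ)) ↔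
        ω₁ * z = ω₁ * w + (k 0 * ω₁ + k 1 * ω₂) := by
      intro k
      rw [← hb.1.eq_iff, hc, hFΨ, hFΨ, hω]
    rw [sameTorusPoint_iff]
    simp only [hk]
    constructor
    · rintro ⟨a, b, hab⟩
      refine ⟨![a, b * ε], ?_⟩
      simp
      linear_combination ω₁ * hab + b * hτ
    · rintro ⟨k, hk⟩
      refine ⟨k 0, k 1 * ε, mul_left_cancel₀ hω0 ?_⟩
      push_cast
      linear_combination hk - k 1 * ε * hτ - k 1 * ω₂ * hε'
  · refine ⟨ω₁⁻¹ * F x, ?_⟩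
    simp only [hΨ, mul_inv_cancel_left₀ hω0, hGF]
  · obtain ⟨κ, hκ, h⟩ := hconf (Ψ z)
    refine ⟨κ * Complex.normSq ω₁, mul_pos hκ hn, fun v w => ?_⟩
    rw [h, hdΨ, hdΨ, mul_assoc]
    congr 1
    simp only [Complex.inner, map_mul, Complex.mul_re, Complex.mul_im, Complex.conj_re,
      Complex.conj_im, Complex.normSq_apply]
    ring
  · have hp := hpos (Ψ z)
    have h1 := hdΨ z 1
    have h2 := hdΨ z Complex.I
    set V := fderiv ℝ Ψ z 1
    set U := fderiv ℝ Ψ z Complex.I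
    set p := P (Ψ z)
    set q := Q (Ψ z)
    have key : (V 0 * U 1 - V 1 * U 0) * (conj p * q).im = Complex.normSq ω₁ := by
      have : (conj (covec p q V) * covec p q U).im = Complex.normSq ω₁ := by
        rw [h1, h2]
        simp [Complex.normSq_apply]
      rw [← this, covec_apply, covec_apply]
      simp only [map_add, map_mul, Complex.conj_ofReal, Complex.add_re, Complex.mul_re,
        Complex.ofReal_re, Complex.ofReal_im, Complex.add_im, Complex.mul_im, Complex.conj_re,
        Complex.conj_im]
      ring
    have hdet : (Matrix.of ![V, U]).det = V 0 * U 1 - V 1 * U 0 := by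
      simp [Matrix.det_fin_two]
    rw [hdet]
    exact pos_of_mul_pos_left (key ▸ hn) hp.le

/-- Every smooth Riemannian metric on the torus has a conformal class. -/
theorem exists_conformalDiffeo {g : Plane → Matrix (Fin 2) (Fin 2) ℝ}
    (hs : ∀ i j, ContDiff ℝ ∞ fun x => g x i j) (hper : TorusPeriodic g)
    (hsymm : ∀ x, g x 1 0 = g x 0 1) (hpos : ∀ x, 0 < g x 0 0) (hdet : ∀ x, 0 < (g x).det) :
    ∃ (τ : ℍ) (Ψ : ℂ → Plane), IsConformalDiffeo τ g Ψ := by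
  have hdet' : ∀ x, (g x).det = g x 0 0 * g x 1 1 - g x 0 1 ^ 2 := fun x => by
    rw [Matrix.det_fin_two, hsymm]; ring
  have hG : ∀ x, 0 < g x 1 1 := fun x => by
    have := hdet x
    rw [hdet'] at this
    by_contra! h
    nlinarith [hpos x, sq_nonneg (g x 0 1)]
  set D : Plane → ℝ := fun x => Real.sqrt (g x).det with hD
  have hD0 : ∀ x, 0 < D x := fun x => Real.sqrt_pos.2 (hdet x)
  have hD2 : ∀ x, D x ^ 2 = g x 0 0 * g x 1 1 - g x 0 1 ^ 2 := fun x => by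
    rw [← hdet']; exact Real.sq_sqrt (hdet x).le
  have hDs : ContDiff ℝ ∞ D := by
    refine ContDiff.sqrt ?_ fun x => (hdet x).ne'
    simp only [hdet']
    exact ((hs 0 0).mul (hs 1 1)).sub ((hs 0 1).pow 2)
  set W : Plane → ℝ := fun x => g x 0 0 + g x 1 1 + 2 * D x with hW
  have hW0 : ∀ x, 0 < W x := fun x => by
    have := hpos x; have := hG x; have := hD0 x
    simp only [hW]; linarith
  have hWs : ContDiff ℝ ∞ W := ((hs 0 0).add (hs 1 1)).add (contDiff_const.mul hDs)
  -- Real and imaginary parts of the Beltrami coefficient; the identities `e1`, `e2` and `hbW`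
  -- amount to `g = (W/4) |dz + μ dz̄|²`, while `e3` gives `|μ| < 1`.
  set a : Plane → ℝ := fun x => (g x 0 0 - g x 1 1) / W x with ha
  set b : Plane → ℝ := fun x => 2 * g x 0 1 / W x with hb
  have has : ContDiff ℝ ∞ a := ((hs 0 0).sub (hs 1 1)).div hWs fun x => (hW0 x).ne'
  have hbs : ContDiff ℝ ∞ b := (contDiff_const.mul (hs 0 1)).div hWs fun x => (hW0 x).ne'
  set μ : Plane → ℂ := fun x => a x + b x * Complex.I with hμ
  have hμs : SmoothPer μ := by
    refine ⟨(Complex.ofRealCLM.contDiff.comp has).add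
      ((Complex.ofRealCLM.contDiff.comp hbs).mul contDiff_const), ?_⟩
    intro x y hxy
    simp only [hμ, ha, hb, hW, hD, hper x y hxy]
  have hre : ∀ x, (μ x).re = a x := fun x => by simp [hμ]
  have him : ∀ x, (μ x).im = b x := fun x => by simp [hμ]
  have haW : ∀ x, a x * W x = g x 0 0 - g x 1 1 := fun x => div_mul_cancel₀ _ (hW0 x).ne'
  have hbW : ∀ x, b x * W x = 2 * g x 0 1 := fun x => div_mul_cancel₀ _ (hW0 x).ne'
  have e1 : ∀ x, ((1 + a x) ^ 2 + b x ^ 2) * W x = 4 * g x 0 0 := by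
    intro x
    refine mul_right_cancel₀ (hW0 x).ne' ?_
    have h : ((1 + a x) ^ 2 + b x ^ 2) * W x * W x = (W x + a x * W x) ^ 2 + (b x * W x) ^ 2 := by
      ring
    rw [h, haW, hbW]
    simp only [hW]
    linear_combination 4 * hD2 x
  have e2 : ∀ x, ((1 - a x) ^ 2 + b x ^ 2) * W x = 4 * g x 1 1 := by
    intro x
    refine mul_right_cancel₀ (hW0 x).ne' ?_
    have h : ((1 - a x) ^ 2 + b x ^ 2) * W x * W x = (W x - a x * W x) ^ 2 + (b x * W x) ^ 2 := by
      ring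
    rw [h, haW, hbW]
    simp only [hW]
    linear_combination 4 * hD2 x
  have e3 : ∀ x, (1 - a x ^ 2 - b x ^ 2) * W x = 4 * D x := by
    intro x
    refine mul_right_cancel₀ (hW0 x).ne' ?_
    have h : (1 - a x ^ 2 - b x ^ 2) * W x * W x = W x ^ 2 - (a x * W x) ^ 2 - (b x * W x) ^ 2 := by
      ring
    rw [h, haW, hbW]
    simp only [hW]
    linear_combination (-4) * hD2 x
  have e3' : ∀ x, 0 < 1 - a x ^ 2 - b x ^ 2 := fun x =>
    pos_of_mul_pos_left (by rw [e3]; linarith [hD0 x]) (hW0 x).le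
  have hlt : ∀ x, ‖μ x‖ < 1 := by
    intro x
    rw [← sq_lt_one_iff₀ (norm_nonneg _), ← Complex.normSq_eq_norm_sq, Complex.normSq_apply, hre,
      him]
    nlinarith [e3' x]
  obtain ⟨ψ, F, hψ, hψ0, hF, hFd, hχ⟩ := exists_beltrami_solution hμs hlt
  have hn : ∀ x, 0 < Complex.normSq (ψ x) := fun x => Complex.normSq_pos.2 (hψ0 x)
  refine exists_conformalDiffeo_of_developing hF hFd (fun x => ?_) (fun x => ?_) fun k => ?_
  · have : (conj (ψ x * (1 + μ x)) * (ψ x * (Complex.I * (1 - μ x)))).im =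
        Complex.normSq (ψ x) * (1 - a x ^ 2 - b x ^ 2) := by
      simp only [← hre, ← him, map_mul, map_add, map_one, Complex.mul_re, Complex.mul_im,
        Complex.add_re, Complex.add_im, Complex.sub_re, Complex.sub_im, Complex.conj_re,
        Complex.conj_im, Complex.I_re, Complex.I_im, Complex.one_re, Complex.one_im,
        Complex.normSq_apply]
      ring
    rw [this]
    exact mul_pos (hn x) (e3' x)
  · refine ⟨W x / (4 * Complex.normSq (ψ x)), div_pos (hW0 x) (by linarith [hn x]), fun v u => ?_⟩
    have h1 : (inner ℝ (covec (ψ x * (1 + μ x)) (ψ x * (Complex.I * (1 - μ x))) v)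
        (covec (ψ x * (1 + μ x)) (ψ x * (Complex.I * (1 - μ x))) u) : ℝ) =
        Complex.normSq (ψ x) * (v 0 * u 0 * ((1 + a x) ^ 2 + b x ^ 2) +
          (v 0 * u 1 + v 1 * u 0) * (2 * b x) + v 1 * u 1 * ((1 - a x) ^ 2 + b x ^ 2)) := by
      simp only [covec_apply, Complex.inner, ← hre, ← him, map_mul, map_add, map_one, Complex.mul_re,
        Complex.mul_im, Complex.conj_ofReal, Complex.ofReal_re, Complex.ofReal_im,
        Complex.add_re, Complex.add_im, Complex.sub_re, Complex.sub_im, Complex.conj_re,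
        Complex.conj_im, Complex.I_re, Complex.I_im, Complex.one_re, Complex.one_im,
        Complex.normSq_apply]
      ring
    have h2 : v ⬝ᵥ (g x).mulVec u = v 0 * u 0 * g x 0 0 + (v 0 * u 1 + v 1 * u 0) * g x 0 1 +
        v 1 * u 1 * g x 1 1 := by
      simp only [dotProduct, Matrix.mulVec, Fin.sum_univ_two, hsymm]
      ring
    rw [h1, h2]
    have hn0 := (hn x).ne'
    field_simp
    linear_combination (-(v 0 * u 0)) * e1 x - (v 1 * u 1) * e2 x -
      2 * (v 0 * u 1 + v 1 * u 0) * hbW x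
  · obtain ⟨χ, hχ1, hχk⟩ := hχ k
    have hμk : ∀ x, μ (x + fun i => (k i : ℝ)) = μ x := fun x =>
      hμs.periodic _ _ (sameTorusPoint_add_int x k)
    -- As `μ` is periodic and `ψ` picks up the factor `χ`, so does `dF`; hence `F` satisfies the
    -- equivariance up to a constant.
    have hzero : ∀ x, HasFDerivAt (fun x => F (x + fun i => (k i : ℝ)) - χ * F x)
        (0 : Plane →L[ℝ] ℂ) x := by
      intro x
      have h1 : HasFDerivAt (fun x => F (x + fun i => (k i : ℝ))) _ x :=
        (hFd (x + fun i => (k i : ℝ))).comp x ((hasFDerivAt_id x).add_const _)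
      refine (h1.sub ((hFd x).const_mul χ)).congr_fderiv ?_
      ext v
      simp only [hχk, hμk, covec_apply, _root_.sub_apply, _root_.smul_apply, smul_eq_mul,
        _root_.zero_apply, ContinuousLinearMap.comp_id]
      ring
    have hconst := is_const_of_fderiv_eq_zero (𝕜 := ℝ)
      (fun x => (hzero x).differentiableAt) (fun x => (hzero x).fderiv)
    refine ⟨χ, F (0 + fun i => (k i : ℝ)) - χ * F 0, hχ1, fun x => ?_⟩
    have := hconst x 0
    linear_combination this

end FrameEnergy

end

noncomputable section

open MeasureTheory Set ComplexConjugate Topology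

namespace FrameEnergy

/-! ### Conformal invariance of the frame energy -/

/-- The half-open unit square. -/
def cell : Set Plane := Set.pi Set.univ fun _ => Set.Ico (0 : ℝ) 1

lemma exists_sameTorusPoint_mem_cell (x : Plane) : ∃ y ∈ cell, SameTorusPoint x y :=
  ⟨fun i => Int.fract (x i), fun i _ => ⟨Int.fract_nonneg _, Int.fract_lt_one _⟩,
    fun i => ⟨⌊x i⌋, by simp [Int.self_sub_fract]⟩⟩

lemma SameTorusPoint.eq_of_mem_cell {x y : Plane} (h : SameTorusPoint x y) (hx : x ∈ cell)
    (hy : y ∈ cell) : x = y := by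
  ext i
  obtain ⟨k, hk⟩ := h i
  have h1 := hx i trivial
  have h2 := hy i trivial
  have h3 : (k : ℝ) < 1 := by rw [← hk]; linarith [h1.2, h2.1]
  have h4 : (-1 : ℝ) < k := by rw [← hk]; linarith [h1.1, h2.2]
  have h5 : k = 0 := by
    have : k < 1 := by exact_mod_cast h3
    have : -1 < k := by exact_mod_cast h4
    omega
  rw [h5] at hk
  simpa [sub_eq_zero] using hk

lemma measurableSet_cell : MeasurableSet cell := MeasurableSet.univ_pi fun _ => measurableSet_Ico

lemma setIntegral_cell {F : Type*} [NormedAddCommGroup F] [NormedSpace ℝ F] (f : Plane → F) :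
    ∫ x in cell, f x = ∫ x in Icc (0 : Plane) 1, f x :=
  setIntegral_congr_set Measure.univ_pi_Ico_ae_eq_Icc

/-- The lattice `ℤ²`. -/
abbrev intLattice : AddSubgroup Plane :=
  (Submodule.span ℤ (Set.range (Pi.basisFun ℝ (Fin 2)))).toAddSubgroup

instance : Countable intLattice :=
  inferInstanceAs (Countable (Submodule.span ℤ (Set.range (Pi.basisFun ℝ (Fin 2)))))

lemma sameTorusPoint_iff_mem_intLattice {x y : Plane} :
    SameTorusPoint x y ↔ x - y ∈ intLattice := by
  rw [Submodule.mem_toAddSubgroup, Module.Basis.mem_span_iff_repr_mem]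
  refine forall_congr' fun i => ?_
  simp [eq_comm]

/-- Change of variables for a map of the plane inducing a bijection of tori. -/
lemma integral_comp_torus_map {q : Plane → ℝ} (hq : TorusPeriodic q) {Θ : Plane → Plane}
    {Θ' : Plane → Plane →L[ℝ] Plane} (hΘ : ∀ x, HasFDerivAt Θ (Θ' x) x)
    (hdesc : ∀ s s', SameTorusPoint s s' ↔ SameTorusPoint (Θ s) (Θ s'))
    (hsurj : Function.Surjective Θ) :
    ∫ x in Icc (0 : Plane) 1, q x = ∫ s in Icc (0 : Plane) 1, |(Θ' s).det| * q (Θ s) := by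
  have hinj : InjOn Θ cell := fun s hs s' hs' h =>
    ((hdesc s s').2 (h ▸ fun i => ⟨0, by simp⟩)).eq_of_mem_cell hs hs'
  have hd : ∀ s ∈ cell, HasFDerivWithinAt Θ (Θ' s) cell s := fun s _ => (hΘ s).hasFDerivWithinAt
  have h1 : IsAddFundamentalDomain intLattice cell (volume : Measure Plane) := by
    have := ZSpan.isAddFundamentalDomain' (Pi.basisFun ℝ (Fin 2)) (volume : Measure Plane)
    rwa [ZSpan.fundamentalDomain_pi_basisFun] at this
  -- A bijection of tori sends the cell to a set meeting every lattice orbit exactly once; periodic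
  -- functions have the same integral over any two fundamental domains.
  have h2 : IsAddFundamentalDomain intLattice (Θ '' cell) (volume : Measure Plane) := by
    refine .mk' (measurable_image_of_fderivWithin measurableSet_cell hd hinj).nullMeasurableSet
      fun x => ?_
    obtain ⟨s, rfl⟩ := hsurj x
    obtain ⟨s₀, hs₀, hss⟩ := exists_sameTorusPoint_mem_cell s
    refine ⟨⟨Θ s₀ - Θ s, sameTorusPoint_iff_mem_intLattice.1 ((hdesc _ _).1 hss.symm)⟩,
      ⟨s₀, hs₀, ?_⟩, ?_⟩
    · simp [AddSubgroup.vadd_def]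
    · rintro ⟨l, hl⟩ ⟨s₁, hs₁, h⟩
      have h' : Θ s₁ = l + Θ s := h
      have h3 : SameTorusPoint (Θ s₁) (Θ s) := by
        rw [sameTorusPoint_iff_mem_intLattice, h']; simpa using hl
      have h4 := (((hdesc _ _).2 h3).trans hss).eq_of_mem_cell hs₁ hs₀
      ext1
      simp [← h4, h']
  rw [← setIntegral_cell, ← setIntegral_cell, h1.setIntegral_eq h2 fun g x => ?_,
    integral_image_eq_integral_abs_det_fderiv_smul volume measurableSet_cell hd hinj]
  · rfl
  · refine hq _ _ (sameTorusPoint_iff_mem_intLattice.2 ?_)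
    simp [AddSubgroup.vadd_def]

lemma fderiv_eq_sum_pd {m : ℕ} (f : Plane → E m) (x v : Plane) :
    fderiv ℝ f x v = v 0 • pd 0 f x + v 1 • pd 1 f x := by
  have hv : v = v 0 • Pi.single 0 1 + v 1 • Pi.single 1 1 := by
    ext i; fin_cases i <;> simp
  conv_lhs => rw [hv]
  rw [map_add, map_smul, map_smul, pd, pd]

/-- Pointwise conformal invariance. With `M` the matrix of columns `V`, `U`, the hypotheses say `Mᵀ
G M = ρ I`, so `G⁻¹ = ρ⁻¹ M Mᵀ` and `det M √(det G) = ρ`; the two powers of `ρ` cancel because the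
dimension is two. -/
lemma det_mul_density {m : ℕ} {G : Matrix (Fin 2) (Fin 2) ℝ} {V U : Plane} {ρ : ℝ} (hρ : 0 < ρ)
    (hJ : 0 < V 0 * U 1 - V 1 * U 0) (h11 : V ⬝ᵥ G.mulVec V = ρ) (h12 : V ⬝ᵥ G.mulVec U = 0)
    (h21 : U ⬝ᵥ G.mulVec V = 0) (h22 : U ⬝ᵥ G.mulVec U = ρ) (X : Fin 2 → E m) :
    (V 0 * U 1 - V 1 * U 0) * ((∑ i, ∑ j, G⁻¹ i j * inner ℝ (X i) (X j)) * Real.sqrt G.det) =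
      ‖V 0 • X 0 + V 1 • X 1‖ ^ 2 + ‖U 0 • X 0 + U 1 • X 1‖ ^ 2 := by
  set M : Matrix (Fin 2) (Fin 2) ℝ := !![V 0, U 0; V 1, U 1] with hM
  have hMG : M.transpose * G * M = ρ • (1 : Matrix (Fin 2) (Fin 2) ℝ) := by
    simp only [dotProduct, Matrix.mulVec, Fin.sum_univ_two] at h11 h12 h21 h22
    ext i j
    fin_cases i <;> fin_cases j <;>
      simp [hM, Matrix.mul_apply, Fin.sum_univ_two] <;> linarith
  have hMdet : M.det = V 0 * U 1 - V 1 * U 0 := by rw [hM, Matrix.det_fin_two_of]; ring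
  have hdet : (V 0 * U 1 - V 1 * U 0) ^ 2 * G.det = ρ ^ 2 := by
    have := congrArg Matrix.det hMG
    rw [Matrix.det_mul, Matrix.det_mul, Matrix.det_transpose, Matrix.det_smul, Matrix.det_one,
      hMdet, Fintype.card_fin] at this
    linarith
  have hsqrt : (V 0 * U 1 - V 1 * U 0) * Real.sqrt G.det = ρ := by
    rw [← Real.sqrt_sq hJ.le, ← Real.sqrt_mul (sq_nonneg _), hdet, Real.sqrt_sq hρ.le]
  have hinv : G⁻¹ = ρ⁻¹ • (M * M.transpose) := by
    refine Matrix.inv_eq_left_inv ?_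
    have h1 : (ρ⁻¹ • (M.transpose * G)) * M = 1 := by
      rw [Matrix.smul_mul, hMG, smul_smul, inv_mul_cancel₀ hρ.ne', one_smul]
    rw [Matrix.smul_mul, Matrix.mul_assoc, ← Matrix.mul_smul]
    exact mul_eq_one_comm.1 h1
  have hent : ∀ i j, G⁻¹ i j = ρ⁻¹ * (V i * V j + U i * U j) := by
    intro i j
    rw [hinv, Matrix.smul_apply, Matrix.mul_apply, Fin.sum_univ_two]
    fin_cases i <;> fin_cases j <;> simp [hM]
  rw [mul_left_comm, hsqrt]
  simp only [hent, Fin.sum_univ_two, norm_add_sq_real, norm_smul, mul_pow, inner_smul_left,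
    inner_smul_right, real_inner_self_eq_norm_sq, real_inner_comm (X 0) (X 1), Real.norm_eq_abs,
    sq_abs, conj_trivial]
  field_simp
  ring

/-- The linear parametrization `(s, r) ↦ s + r τ` of the flat torus. -/
def flatMap (τ : ℍ) : Plane →L[ℝ] ℂ := covec 1 τ

lemma flatMap_apply (τ : ℍ) (s : Plane) : flatMap τ s = s 0 + s 1 * τ := by
  simp [flatMap, covec_apply]

lemma flatMap_injective (τ : ℍ) : Function.Injective (flatMap τ) :=
  covec_injective (by simpa using τ.im_pos)

lemma flatMap_surjective (τ : ℍ) : Function.Surjective (flatMap τ) := by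
  obtain ⟨e, he⟩ := exists_continuousLinearEquiv (flatMap_injective τ)
  rw [← he]
  exact e.surjective

lemma sameTorusPoint_iff_sameFlatPoint (τ : ℍ) (s s' : Plane) :
    SameTorusPoint s s' ↔ SameFlatPoint τ (flatMap τ s) (flatMap τ s') := by
  rw [sameTorusPoint_iff]
  constructor
  · rintro ⟨k, rfl⟩
    exact ⟨k 0, k 1, by simp [flatMap_apply]; ring⟩
  · rintro ⟨a, b, h⟩
    refine ⟨![a, b], flatMap_injective τ ?_⟩
    rw [map_add, ← sub_eq_iff_eq_add', h]
    simp [flatMap_apply]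

/-- Sum of the squared norms of the partial derivatives of a map on `ℂ`. -/
def flatDensity {m : ℕ} (f : ℂ → E m) (z : ℂ) : ℝ :=
  ‖fderiv ℝ f z 1‖ ^ 2 + ‖fderiv ℝ f z Complex.I‖ ^ 2

lemma frameDensity_conformal {m : ℕ} {Φ : Plane → E m} {e : Fin 2 → Plane → E m} {τ : ℍ}
    {Ψ : ℂ → Plane} (he : ∀ k, Differentiable ℝ (e k)) (h : IsConformalDiffeo τ (inducedMetric Φ) Ψ)
    (z : ℂ) : (fderiv ℝ Ψ z 1 0 * fderiv ℝ Ψ z Complex.I 1 -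
      fderiv ℝ Ψ z 1 1 * fderiv ℝ Ψ z Complex.I 0) *
      (frameDensity Φ e (Ψ z) * Real.sqrt (inducedMetric Φ (Ψ z)).det) =
      ∑ k, flatDensity (fun z => e k (Ψ z)) z := by
  obtain ⟨ρ, hρ, hc⟩ := h.conformal z
  have hJ := h.orientation z
  have hdet : (Matrix.of ![fderiv ℝ Ψ z 1, fderiv ℝ Ψ z Complex.I]).det =
      fderiv ℝ Ψ z 1 0 * fderiv ℝ Ψ z Complex.I 1 -
      fderiv ℝ Ψ z 1 1 * fderiv ℝ Ψ z Complex.I 0 := by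
    simp [Matrix.det_fin_two]
  rw [hdet] at hJ
  have hch : ∀ k v, fderiv ℝ (fun z => e k (Ψ z)) z v =
      fderiv ℝ Ψ z v 0 • pd 0 (e k) (Ψ z) + fderiv ℝ Ψ z v 1 • pd 1 (e k) (Ψ z) := by
    intro k v
    have h1 : HasFDerivAt (fun z => e k (Ψ z)) _ z :=
      (he k (Ψ z)).hasFDerivAt.comp z (h.smooth.differentiable (by simp) z).hasFDerivAt
    rw [h1.fderiv, ContinuousLinearMap.comp_apply, fderiv_eq_sum_pd]
  simp only [flatDensity, hch]
  rw [frameDensity, Finset.sum_mul, Finset.mul_sum]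
  refine Finset.sum_congr rfl fun k _ => ?_
  refine det_mul_density hρ hJ ?_ ?_ ?_ ?_ fun i => pd i (e k) (Ψ z)
  all_goals
    rw [hc]
    simp [Complex.inner]

lemma TorusPeriodic.pd {m : ℕ} {f : Plane → E m} (h : TorusPeriodic f) (i : Fin 2) :
    TorusPeriodic (pd i f) := h.fderiv.comp fun L => L (Pi.single i 1)

lemma torusPeriodic_inducedMetric {m : ℕ} {Φ : Plane → E m} (h : TorusPeriodic Φ) :
    TorusPeriodic (inducedMetric Φ) := fun x y hxy => by
  simp only [inducedMetric, h.pd _ x y hxy]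

/-- Conformal invariance of the frame energy. -/
lemma frameEnergy_eq {m : ℕ} {Φ : Plane → E m} {e : Fin 2 → Plane → E m} {τ : ℍ} {Ψ : ℂ → Plane}
    (hΦ : TorusPeriodic Φ) (he : ∀ k, IsSmoothTorusMap (e k))
    (h : IsConformalDiffeo τ (inducedMetric Φ) Ψ) :
    frameEnergy Φ e = 1 / 4 * (τ.im *
      ∫ s in Icc (0 : Plane) 1, ∑ k, flatDensity (fun z => e k (Ψ z)) (flatMap τ s)) := by
  have hq : TorusPeriodic fun x =>
      frameDensity Φ e x * Real.sqrt (inducedMetric Φ x).det := by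
    intro x y hxy
    have h1 : ∀ i k, FrameEnergy.pd i (e k) x = FrameEnergy.pd i (e k) y := fun i k =>
      TorusPeriodic.pd (he k).periodic i x y hxy
    simp only [frameDensity, torusPeriodic_inducedMetric hΦ x y hxy, h1]
  have hΨd := h.smooth.differentiable (by simp)
  have hΘ : ∀ s, HasFDerivAt (fun s => Ψ (flatMap τ s))
      ((fderiv ℝ Ψ (flatMap τ s)).comp (flatMap τ)) s := fun s =>
    (hΨd _).hasFDerivAt.comp s (flatMap τ).hasFDerivAt
  rw [frameEnergy, integral_comp_torus_map hq hΘ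
    (fun s s' => (sameTorusPoint_iff_sameFlatPoint τ s s').trans (h.descends _ _))
    (h.surjective.comp (flatMap_surjective τ)), ← integral_const_mul τ.im]
  congr 2
  ext s
  set L := fderiv ℝ Ψ (flatMap τ s) with hL
  have hJ := h.orientation (flatMap τ s)
  have hdet1 : (Matrix.of ![L 1, L Complex.I]).det = L 1 0 * L Complex.I 1 - L 1 1 * L Complex.I 0 := by
    simp [Matrix.det_fin_two]
  -- The factor `τ.im` is the area of the period parallelogram.
  have hdet : (L.comp (flatMap τ)).det = τ.im * (L 1 0 * L Complex.I 1 - L 1 1 * L Complex.I 0) := by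
    have h0 : L.comp (flatMap τ) (Pi.single 0 1) = L 1 := by
      simp [flatMap_apply]
    have h1 : L.comp (flatMap τ) (Pi.single 1 1) = τ.re • L 1 + τ.im • L Complex.I := by
      rw [← map_smul, ← map_smul, ← map_add]
      simp only [ContinuousLinearMap.comp_apply, flatMap_apply]
      congr 1
      apply Complex.ext <;> simp
    rw [ContinuousLinearMap.det, ← LinearMap.det_toMatrix (Pi.basisFun ℝ (Fin 2)),
      Matrix.det_fin_two]
    simp only [LinearMap.toMatrix_apply, Pi.basisFun_apply, Pi.basisFun_repr,
      ContinuousLinearMap.coe_coe, h0, h1]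
    simp
    ring
  rw [← hL, hdet1] at hJ
  rw [hdet, abs_of_pos (mul_pos τ.im_pos hJ), mul_assoc,
    frameDensity_conformal (fun k => (he k).smooth.differentiable (by simp)) h]

end FrameEnergy

end

noncomputable section

open MeasureTheory Set Topology

namespace FrameEnergy

/-! ### Lower bound for the frame energy on a flat torus -/

/-- The tangent indicatrix of a closed curve has energy at least one. -/
lemma one_le_integral_of_closed {F : Type*} [NormedAddCommGroup F] [InnerProductSpace ℝ F]
    [CompleteSpace F] {γ T T' : ℝ → F} {c : ℝ → ℝ} (hc : ∀ s, 0 < c s) (hT : ∀ s, ‖T s‖ = 1)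
    (hT' : ∀ s, HasDerivAt T (T' s) s) (hcont : Continuous T')
    (hγ : ∀ s, HasDerivAt γ (c s • T s) s) (hclosed : γ 1 = γ 0) :
    1 ≤ ∫ s in (0 : ℝ)..1, ‖T' s‖ ^ 2 := by
  by_contra! hlt
  have hn : Continuous fun s => ‖T' s‖ := hcont.norm
  -- From `2‖T'‖ ≤ 1 + ‖T'‖²`: small energy forces the tangent to travel a distance less than 1.
  have h1 : ∫ s in (0 : ℝ)..1, ‖T' s‖ < 1 := by
    have : ∫ s in (0 : ℝ)..1, ‖T' s‖ ≤ ∫ s in (0 : ℝ)..1, (1 / 2 + 1 / 2 * ‖T' s‖ ^ 2) := by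
      refine intervalIntegral.integral_mono_on zero_le_one (hn.intervalIntegrable _ _)
        (Continuous.intervalIntegrable (by fun_prop) _ _) fun s _ => ?_
      nlinarith [sq_nonneg (‖T' s‖ - 1)]
    rw [intervalIntegral.integral_add (by simp) (Continuous.intervalIntegrable (by fun_prop) _ _),
      intervalIntegral.integral_const_mul] at this
    simp at this
    linarith
  have hd : ∀ s ∈ Icc (0 : ℝ) 1, ‖T s - T 0‖ < 1 := by
    intro s hs
    rw [← intervalIntegral.integral_eq_sub_of_hasDerivAt (fun x _ => hT' x)
      (hcont.intervalIntegrable _ _)]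
    refine (intervalIntegral.norm_integral_le_integral_norm hs.1).trans_lt (lt_of_le_of_lt ?_ h1)
    exact intervalIntegral.integral_mono_interval le_rfl hs.1 hs.2
      (Filter.Eventually.of_forall fun x => norm_nonneg _) (hn.intervalIntegrable _ _)
  have hderiv : ∀ s, HasDerivAt (fun s => inner ℝ (T 0) (γ s)) (inner ℝ (T 0) (c s • T s)) s := by
    intro s
    have := (hasDerivAt_const s (T 0)).inner ℝ (hγ s)
    simpa using this
  -- Rolle on the closed curve gives a tangent orthogonal to `T 0`, hence at squared distance 2 from
  -- it, although all tangents lie within distance 1.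
  obtain ⟨s, hs, h0⟩ := exists_hasDerivAt_eq_zero (f := fun s => inner ℝ (T 0) (γ s))
    (f' := fun s => inner ℝ (T 0) (c s • T s)) zero_lt_one
    (fun s _ => (hderiv s).continuousAt.continuousWithinAt) (by simp only [hclosed])
    fun s _ => hderiv s
  have h2 := hd s ⟨hs.1.le, hs.2.le⟩
  have h3 : ‖T s - T 0‖ ^ 2 < 1 := by nlinarith [norm_nonneg (T s - T 0)]
  rw [norm_sub_sq_real, hT, hT, real_inner_comm] at h3
  rw [inner_smul_right] at h0
  rcases mul_eq_zero.1 h0 with h | h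
  · exact (hc s).ne' h
  · rw [h] at h3; norm_num at h3

lemma one_le_setIntegral_of_lines {f : Plane → ℝ} (hf : Continuous f)
    (h : ∀ r, 1 ≤ ∫ s in (0 : ℝ)..1, f ![s, r]) : 1 ≤ ∫ x in Icc (0 : Plane) 1, f x := by
  have hmp := volume_preserving_finTwoArrow ℝ
  have hset : Icc (0 : Plane) 1 =
      MeasurableEquiv.finTwoArrow ⁻¹' (Icc (0 : ℝ) 1 ×ˢ Icc (0 : ℝ) 1) := by
    ext x
    simp [Pi.le_def, Fin.forall_fin_two]
  have hfx : ∀ x : Plane, f x = (fun p : ℝ × ℝ => f ![p.1, p.2]) (MeasurableEquiv.finTwoArrow x) := by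
    intro x
    congr 1
    ext i
    fin_cases i <;> rfl
  have hc : Continuous fun p : ℝ × ℝ => f ![p.1, p.2] := by
    refine hf.comp (continuous_pi fun i => ?_)
    fin_cases i
    · exact continuous_fst
    · exact continuous_snd
  have hi : IntegrableOn (fun p : ℝ × ℝ => f ![p.1, p.2]) (Icc (0 : ℝ) 1 ×ˢ Icc (0 : ℝ) 1)
      (volume.prod volume) :=
    (hc.continuousOn.integrableOn_compact (isCompact_Icc.prod isCompact_Icc))
  have e : ∫ x in Icc (0 : Plane) 1, f x =
      ∫ r in Icc (0 : ℝ) 1, ∫ s in Icc (0 : ℝ) 1, f ![s, r] := by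
    rw [integral_congr_ae (Filter.Eventually.of_forall hfx), hset, hmp.setIntegral_preimage_emb (MeasurableEquiv.measurableEmbedding _)
      (fun p : ℝ × ℝ => f ![p.1, p.2]), Measure.volume_eq_prod, ← setIntegral_prod_swap]
    exact setIntegral_prod _ hi.swap
  rw [e]
  refine (show (1 : ℝ) = ∫ _ in Icc (0 : ℝ) 1, (1 : ℝ) by simp).le.trans ?_
  refine setIntegral_mono continuous_const.integrableOn_Icc ?_ fun r => ?_
  · rw [IntegrableOn, ← Measure.prod_restrict] at hi
    exact hi.integral_prod_right
  · have := h r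
    rwa [intervalIntegral.integral_of_le zero_le_one, ← integral_Icc_eq_integral_Ioc] at this

/-- Periodicity with respect to the lattice `ℤ + τ ℤ`. -/
def FlatPeriodic {F : Type*} (τ : ℍ) (f : ℂ → F) : Prop := ∀ z w, SameFlatPoint τ z w → f z = f w

lemma FlatPeriodic.fderiv {F : Type*} [NormedAddCommGroup F] [NormedSpace ℝ F] {τ : ℍ} {f : ℂ → F}
    (h : FlatPeriodic τ f) : FlatPeriodic τ (fderiv ℝ f) := by
  intro z w hzw
  have e : f = fun u => f (u + (z - w)) := by
    ext u
    refine h _ _ ?_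
    obtain ⟨a, b, hab⟩ := hzw
    refine ⟨-a, -b, ?_⟩
    push_cast
    linear_combination -hab
  have h2 : _root_.fderiv ℝ f w = _root_.fderiv ℝ f (w + (z - w)) := by
    conv_lhs => rw [e]
    rw [fderiv_comp_add_right]
  rw [h2, add_sub_cancel]

lemma FlatPeriodic.torusPeriodic {F : Type*} {τ : ℍ} {f : ℂ → F} (h : FlatPeriodic τ f) :
    TorusPeriodic fun s => f (flatMap τ s) := fun s s' hs =>
  h _ _ ((sameTorusPoint_iff_sameFlatPoint τ s s').1 hs)

lemma integral_fderiv_flatMap {τ : ℍ} {R : ℂ → ℝ} (hR : ContDiff ℝ 1 R) (h : FlatPeriodic τ R)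
    (v : ℂ) : ∫ s in Icc (0 : Plane) 1, fderiv ℝ R (flatMap τ s) v = 0 := by
  obtain ⟨u, rfl⟩ := flatMap_surjective τ v
  have hRA : ContDiff ℝ 1 fun s => R (flatMap τ s) := hR.comp (flatMap τ).contDiff
  have hu : u = u 0 • Pi.single 0 1 + u 1 • Pi.single 1 1 := by
    ext i; fin_cases i <;> simp
  have e : ∀ s, fderiv ℝ R (flatMap τ s) (flatMap τ u) =
      u 0 * fderiv ℝ (fun s => R (flatMap τ s)) s (Pi.single 0 1) +
      u 1 * fderiv ℝ (fun s => R (flatMap τ s)) s (Pi.single 1 1) := by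
    intro s
    have h1 : HasFDerivAt (fun s => R (flatMap τ s)) _ s :=
      (hR.differentiable one_ne_zero _).hasFDerivAt.comp s (flatMap τ).hasFDerivAt
    rw [h1.fderiv, ContinuousLinearMap.comp_apply, ContinuousLinearMap.comp_apply]
    conv_lhs => rw [hu]
    simp only [map_add, map_smul, smul_eq_mul]
  have hc : ∀ i : Fin 2, Continuous fun s =>
      fderiv ℝ (fun s => R (flatMap τ s)) s (Pi.single i 1) := fun i =>
    (hRA.continuous_fderiv one_ne_zero).clm_apply continuous_const
  simp only [e]
  have hi : ∀ i, IntegrableOn (fun s => u i *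
      fderiv ℝ (fun s => R (flatMap τ s)) s (Pi.single i 1)) (Icc (0 : Plane) 1) := fun i =>
    (continuous_const.mul (hc i)).integrableOn_Icc
  rw [integral_add (hi 0) (hi 1), integral_const_mul, integral_const_mul,
    integral_fderiv_single_eq_zero hRA h.torusPeriodic,
    integral_fderiv_single_eq_zero hRA h.torusPeriodic]
  simp

/-- The derivative of a rotated orthonormal frame. -/
lemma norm_sq_rotated_frame {F : Type*} [NormedAddCommGroup F] [InnerProductSpace ℝ F]
    {t n T N : F} {a b a' b' : ℝ} (htt : inner ℝ t t = (1 : ℝ)) (hnn : inner ℝ n n = (1 : ℝ))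
    (htn : inner ℝ t n = (0 : ℝ)) (hT : inner ℝ t T = (0 : ℝ)) (hN : inner ℝ n N = (0 : ℝ))
    (hTN : inner ℝ T n + inner ℝ t N = (0 : ℝ)) (hab : a ^ 2 + b ^ 2 = 1)
    (hab' : a * a' + b * b' = 0) :
    ‖(a • T + a' • t) + (b • N + b' • n)‖ ^ 2 + ‖(-b • T + -b' • t) + (a • N + a' • n)‖ ^ 2 =
      ‖T‖ ^ 2 + ‖N‖ ^ 2 + 4 * (inner ℝ T n * (a * b' - b * a')) + 2 * (a * b' - b * a') ^ 2 := by
  have hT' : inner ℝ T t = (0 : ℝ) := by rw [real_inner_comm]; exact hT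
  have hN' : inner ℝ N n = (0 : ℝ) := by rw [real_inner_comm]; exact hN
  have hnt : inner ℝ n t = (0 : ℝ) := by rw [real_inner_comm]; exact htn
  have h1 : inner ℝ t N = -(inner ℝ T n : ℝ) := by linarith
  have h2 : inner ℝ N t = -(inner ℝ T n : ℝ) := by rw [real_inner_comm]; exact h1
  have h3 : (inner ℝ n T : ℝ) = inner ℝ T n := real_inner_comm _ _
  have h4 : (inner ℝ N T : ℝ) = inner ℝ T N := real_inner_comm _ _
  simp only [← real_inner_self_eq_norm_sq, inner_add_left, inner_add_right, real_inner_smul_left,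
    real_inner_smul_right, htt, hnn, htn, hT, hN, hT', hN', hnt, h1, h2, h3, h4]
  -- The vector `(a', b')` is orthogonal to the unit vector `(a, b)`, so its length is the modulus
  -- of the angular speed.
  have h5 : a' ^ 2 + b' ^ 2 = (a * b' - b * a') ^ 2 := by
    linear_combination (-(a' ^ 2 + b' ^ 2)) * hab + (a * a' + b * b') * hab'
  linear_combination (inner ℝ T T + inner ℝ N N) * hab + 2 * h5

section Flat

variable {F : Type*} [NormedAddCommGroup F] [InnerProductSpace ℝ F]

lemma fderiv_fderiv_comm {f : ℂ → F} (hf : ContDiff ℝ ∞ f) (z u v : ℂ) :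
    fderiv ℝ (fun z => fderiv ℝ f z u) z v = fderiv ℝ (fun z => fderiv ℝ f z v) z u := by
  have h1 : DifferentiableAt ℝ (fderiv ℝ f) z :=
    (hf.fderiv_right (m := ∞) (by simp)).differentiable (by simp) z
  have h2 : ∀ u, fderiv ℝ (fun z => fderiv ℝ f z u) z = (fderiv ℝ (fderiv ℝ f) z).flip u := by
    intro u
    have : HasFDerivAt (fun z => fderiv ℝ f z u) _ z :=
      h1.hasFDerivAt.clm_apply (hasFDerivAt_const u z)
    rw [this.fderiv]
    ext w
    simp
  rw [h2, h2]
  exact (hf.contDiffAt.isSymmSndFDerivAt (by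
    rw [minSmoothness_of_isRCLikeNormedField]
    exact WithTop.coe_le_coe.2 (le_top : (2 : ℕ∞) ≤ ⊤))) v u

lemma inner_fderiv_add_of_const {f g : ℂ → F} (hf : Differentiable ℝ f) (hg : Differentiable ℝ g)
    {c : ℝ} (h : ∀ z, inner ℝ (f z) (g z) = c) (z v : ℂ) :
    inner ℝ (f z) (fderiv ℝ g z v) + inner ℝ (fderiv ℝ f z v) (g z) = (0 : ℝ) := by
  rw [← fderiv_inner_apply ℝ (hf z) (hg z)]
  simp [h]

end Flat

end FrameEnergy

end

/-! ### Comparison of an arbitrary frame with the coordinate frame -/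

noncomputable section

open MeasureTheory Set Topology

namespace FrameEnergy

/-- Here `(a, b) = (cos θ, sin θ)` and `a db - b da = dθ`. The angle `θ` itself need not be
periodic, so only `a` and `b` appear. -/
lemma flatDensity_frame_eq {m : ℕ} {t n f₀ f₁ : ℂ → E m} {a b : ℂ → ℝ}
    (ht : Differentiable ℝ t) (hn : Differentiable ℝ n) (ha : Differentiable ℝ a)
    (hb : Differentiable ℝ b) (htt : ∀ z, inner ℝ (t z) (t z) = (1 : ℝ))
    (hnn : ∀ z, inner ℝ (n z) (n z) = (1 : ℝ)) (htn : ∀ z, inner ℝ (t z) (n z) = (0 : ℝ))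
    (hab : ∀ z, a z ^ 2 + b z ^ 2 = 1) (h₀ : ∀ z, f₀ z = a z • t z + b z • n z)
    (h₁ : ∀ z, f₁ z = -b z • t z + a z • n z) (z v : ℂ) :
    ‖fderiv ℝ f₀ z v‖ ^ 2 + ‖fderiv ℝ f₁ z v‖ ^ 2 =
      ‖fderiv ℝ t z v‖ ^ 2 + ‖fderiv ℝ n z v‖ ^ 2 +
      4 * (inner ℝ (fderiv ℝ t z v) (n z) * (a z * fderiv ℝ b z v - b z * fderiv ℝ a z v)) +
      2 * (a z * fderiv ℝ b z v - b z * fderiv ℝ a z v) ^ 2 := by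
  have hT : inner ℝ (t z) (fderiv ℝ t z v) = (0 : ℝ) := by
    have := inner_fderiv_add_of_const ht ht htt z v
    rw [real_inner_comm (t z) (fderiv ℝ t z v)] at this
    linarith
  have hN : inner ℝ (n z) (fderiv ℝ n z v) = (0 : ℝ) := by
    have := inner_fderiv_add_of_const hn hn hnn z v
    rw [real_inner_comm (n z) (fderiv ℝ n z v)] at this
    linarith
  have hTN := inner_fderiv_add_of_const ht hn htn z v
  have hab' : a z * fderiv ℝ a z v + b z * fderiv ℝ b z v = 0 := by
    have h1 : HasFDerivAt (fun z => a z ^ 2 + b z ^ 2) _ z :=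
      ((ha z).hasFDerivAt.pow 2).add ((hb z).hasFDerivAt.pow 2)
    simp only [hab] at h1
    have h2 := congrArg (fun L : ℂ →L[ℝ] ℝ => L v) (h1.unique (hasFDerivAt_const _ _))
    simp at h2
    linarith
  have e₀ : fderiv ℝ f₀ z v = (a z • fderiv ℝ t z v + fderiv ℝ a z v • t z) +
      (b z • fderiv ℝ n z v + fderiv ℝ b z v • n z) := by
    have : HasFDerivAt (fun z => a z • t z + b z • n z) _ z :=
      ((ha z).hasFDerivAt.smul (ht z).hasFDerivAt).add
        ((hb z).hasFDerivAt.smul (hn z).hasFDerivAt)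
    rw [funext h₀, this.fderiv]
    simp
  have e₁ : fderiv ℝ f₁ z v = (-b z • fderiv ℝ t z v + -fderiv ℝ b z v • t z) +
      (a z • fderiv ℝ n z v + fderiv ℝ a z v • n z) := by
    have : HasFDerivAt (fun z => -b z • t z + a z • n z) _ z :=
      ((hb z).hasFDerivAt.neg.smul (ht z).hasFDerivAt).add
        ((ha z).hasFDerivAt.smul (hn z).hasFDerivAt)
    rw [funext h₁, this.fderiv]
    simp
  rw [e₀, e₁]
  exact norm_sq_rotated_frame (htt z) (hnn z) (htn z) hT hN (by linarith) (hab z) hab'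

/-- With the periodic closed form `β = a db - b da`, the integrand is the coefficient of `dl ∧ β =
d(l β)`, whose integral over the torus vanishes. -/
lemma integral_cross_term {τ : ℍ} {l a b : ℂ → ℝ} (hl : ContDiff ℝ ∞ l) (ha : ContDiff ℝ ∞ a)
    (hb : ContDiff ℝ ∞ b) (hlp : FlatPeriodic τ l) (hap : FlatPeriodic τ a)
    (hbp : FlatPeriodic τ b) (hab : ∀ z, a z ^ 2 + b z ^ 2 = 1) :
    ∫ s in Icc (0 : Plane) 1, (fun z =>
      -fderiv ℝ l z Complex.I * (a z * fderiv ℝ b z 1 - b z * fderiv ℝ a z 1) +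
      fderiv ℝ l z 1 * (a z * fderiv ℝ b z Complex.I - b z * fderiv ℝ a z Complex.I))
      (flatMap τ s) = 0 := by
  set β : ℂ → ℂ → ℝ := fun v z => a z * fderiv ℝ b z v - b z * fderiv ℝ a z v with hβ
  have hd : ∀ {f : ℂ → ℝ}, ContDiff ℝ ∞ f → ∀ v, ContDiff ℝ ∞ fun z => fderiv ℝ f z v :=
    fun hf v => (hf.fderiv_right (m := ∞) (by simp)).clm_apply contDiff_const
  have hβs : ∀ v, ContDiff ℝ ∞ (β v) := fun v => (ha.mul (hd hb v)).sub (hb.mul (hd ha v))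
  have hβp : ∀ v, FlatPeriodic τ (β v) := fun v z w h => by
    simp only [hβ, hap z w h, hbp z w h, hap.fderiv z w h, hbp.fderiv z w h]
  have hRs : ∀ v, ContDiff ℝ ∞ fun z => l z * β v z := fun v => hl.mul (hβs v)
  have hRp : ∀ v, FlatPeriodic τ fun z => l z * β v z := fun v z w h => by
    simp only [hlp z w h, hβp v z w h]
  have hab' : ∀ z v, a z * fderiv ℝ a z v + b z * fderiv ℝ b z v = 0 := by
    intro z v
    have h1 : HasFDerivAt (fun z => a z ^ 2 + b z ^ 2) _ z :=
      ((ha.differentiable (by simp) z).hasFDerivAt.pow 2).add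
        ((hb.differentiable (by simp) z).hasFDerivAt.pow 2)
    simp only [hab] at h1
    have h2 := congrArg (fun L : ℂ →L[ℝ] ℝ => L v) (h1.unique (hasFDerivAt_const _ _))
    simp at h2
    linarith
  have hβd : ∀ u v z, fderiv ℝ (β v) z u = fderiv ℝ a z u * fderiv ℝ b z v -
      fderiv ℝ b z u * fderiv ℝ a z v + a z * fderiv ℝ (fun z => fderiv ℝ b z v) z u -
      b z * fderiv ℝ (fun z => fderiv ℝ a z v) z u := by
    intro u v z
    have : HasFDerivAt (β v) _ z :=
      ((ha.differentiable (by simp) z).hasFDerivAt.mul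
        ((hd hb v).differentiable (by simp) z).hasFDerivAt).sub
      ((hb.differentiable (by simp) z).hasFDerivAt.mul
        ((hd ha v).differentiable (by simp) z).hasFDerivAt)
    rw [this.fderiv]
    simp
    ring
  have hclosed : ∀ z, fderiv ℝ (β Complex.I) z 1 = fderiv ℝ (β 1) z Complex.I := by
    intro z
    rw [hβd, hβd, fderiv_fderiv_comm ha z 1 Complex.I, fderiv_fderiv_comm hb z 1 Complex.I]
    have h1 := hab' z 1
    have h2 := hab' z Complex.I
    set ax := fderiv ℝ a z 1
    set ay := fderiv ℝ a z Complex.I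
    set bx := fderiv ℝ b z 1
    set by' := fderiv ℝ b z Complex.I
    -- Both derivatives of `(a, b)` are tangent to the circle, so they are parallel and `da ∧ db =
    -- 0`; this is the closedness of `β`.
    have : ax * by' - ay * bx = 0 := by
      linear_combination (-(ax * by' - ay * bx)) * hab z + (a z * by' - b z * ay) * h1 +
        (b z * ax - a z * bx) * h2
    linear_combination 2 * this
  have hRd : ∀ u v z, fderiv ℝ (fun z => l z * β v z) z u =
      l z * fderiv ℝ (β v) z u + fderiv ℝ l z u * β v z := by
    intro u v z
    have : HasFDerivAt (fun z => l z * β v z) _ z :=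
      (hl.differentiable (by simp) z).hasFDerivAt.mul
        ((hβs v).differentiable (by simp) z).hasFDerivAt
    rw [this.fderiv]
    simp
    ring
  have e : ∀ z, -fderiv ℝ l z Complex.I * β 1 z + fderiv ℝ l z 1 * β Complex.I z =
      fderiv ℝ (fun z => l z * β Complex.I z) z 1 -
        fderiv ℝ (fun z => l z * β 1 z) z Complex.I := by
    intro z
    rw [hRd, hRd, hclosed]
    ring
  have hc : ∀ u v, IntegrableOn (fun s : Plane => fderiv ℝ (fun z => l z * β v z) (flatMap τ s) u)
      (Icc (0 : Plane) 1) := fun u v =>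
    ((hd (hRs v) u).continuous.comp (flatMap τ).continuous).integrableOn_Icc
  change ∫ s in Icc (0 : Plane) 1, (-fderiv ℝ l (flatMap τ s) Complex.I * β 1 (flatMap τ s) +
    fderiv ℝ l (flatMap τ s) 1 * β Complex.I (flatMap τ s)) = 0
  simp only [e]
  rw [integral_sub (hc _ _) (hc _ _),
    integral_fderiv_flatMap ((hRs _).of_le (by exact_mod_cast le_top)) (hRp _),
    integral_fderiv_flatMap ((hRs _).of_le (by exact_mod_cast le_top)) (hRp _), sub_zero]

/-- The Dirichlet energy of a frame on a conformally immersed flat torus is bounded below. -/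
lemma one_le_integral_flatDensity {m : ℕ} {τ : ℍ} {φ : ℂ → E m} {f : Fin 2 → ℂ → E m}
    (hφ : ContDiff ℝ ∞ φ) (hφp : FlatPeriodic τ φ) (hf : ∀ k, ContDiff ℝ ∞ (f k))
    (hfp : ∀ k, FlatPeriodic τ (f k))
    (hpos : ∀ z, 0 < (inner ℝ (fderiv ℝ φ z 1) (fderiv ℝ φ z 1) : ℝ))
    (hxy : ∀ z, inner ℝ (fderiv ℝ φ z 1) (fderiv ℝ φ z Complex.I) = (0 : ℝ))
    (hyy : ∀ z, (inner ℝ (fderiv ℝ φ z Complex.I) (fderiv ℝ φ z Complex.I) : ℝ) =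
      inner ℝ (fderiv ℝ φ z 1) (fderiv ℝ φ z 1))
    (hon : ∀ z, Orthonormal ℝ fun k => f k z)
    (htan : ∀ k z, ∃ v, f k z = fderiv ℝ φ z v)
    (hor : ∀ z, (0 : ℝ) < inner ℝ (fderiv ℝ φ z 1) (f 0 z) * inner ℝ (fderiv ℝ φ z Complex.I) (f 1 z) -
      inner ℝ (fderiv ℝ φ z 1) (f 1 z) * inner ℝ (fderiv ℝ φ z Complex.I) (f 0 z)) :
    1 ≤ ∫ s in Icc (0 : Plane) 1, ∑ k, flatDensity (f k) (flatMap τ s) := by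
  set p : ℂ → E m := fun z => fderiv ℝ φ z 1 with hp
  set q : ℂ → E m := fun z => fderiv ℝ φ z Complex.I with hq
  set ρ : ℂ → ℝ := fun z => inner ℝ (p z) (p z) with hρ
  have hd : ∀ {G : Type} [NormedAddCommGroup G] [NormedSpace ℝ G] {f : ℂ → G}, ContDiff ℝ ∞ f →
      ∀ v, ContDiff ℝ ∞ fun z => fderiv ℝ f z v :=
    fun hf v => (hf.fderiv_right (m := ∞) (by simp)).clm_apply contDiff_const
  have hps : ContDiff ℝ ∞ p := hd hφ 1
  have hqs : ContDiff ℝ ∞ q := hd hφ Complex.I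
  have hpp : FlatPeriodic τ p := fun z w h => by simp only [hp, hφp.fderiv z w h]
  have hqp : FlatPeriodic τ q := fun z w h => by simp only [hq, hφp.fderiv z w h]
  have hρs : ContDiff ℝ ∞ ρ := hps.inner ℝ hps
  have hρ0 : ∀ z, 0 < ρ z := hpos
  have hpq : ∀ z, inner ℝ (p z) (q z) = (0 : ℝ) := hxy
  have hqq : ∀ z, inner ℝ (q z) (q z) = ρ z := hyy
  set r : ℂ → ℝ := fun z => (Real.sqrt (ρ z))⁻¹ with hr
  have hsq : ∀ z, 0 < Real.sqrt (ρ z) := fun z => Real.sqrt_pos.2 (hρ0 z)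
  have hrs : ContDiff ℝ ∞ r := (hρs.sqrt fun z => (hρ0 z).ne').inv fun z => (hsq z).ne'
  have hr2 : ∀ z, r z * r z * ρ z = 1 := fun z => by
    have := Real.mul_self_sqrt (hρ0 z).le
    have h0 := (hsq z).ne'
    simp only [hr]
    nth_rewrite 3 [← this]
    field_simp
  set t : ℂ → E m := fun z => r z • p z with ht
  set n : ℂ → E m := fun z => r z • q z with hn
  have hts : ContDiff ℝ ∞ t := hrs.smul hps
  have hns : ContDiff ℝ ∞ n := hrs.smul hqs
  have htt : ∀ z, inner ℝ (t z) (t z) = (1 : ℝ) := fun z => by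
    simp only [ht, real_inner_smul_left, real_inner_smul_right]
    rw [← hr2 z, hρ]; ring
  have hnn : ∀ z, inner ℝ (n z) (n z) = (1 : ℝ) := fun z => by
    simp only [hn, real_inner_smul_left, real_inner_smul_right]
    rw [hqq, ← hr2 z]; ring
  have htn : ∀ z, inner ℝ (t z) (n z) = (0 : ℝ) := fun z => by
    simp only [ht, hn, real_inner_smul_left, real_inner_smul_right]
    rw [hpq, mul_zero, mul_zero]
  set a : ℂ → ℝ := fun z => inner ℝ (t z) (f 0 z) with ha
  set b : ℂ → ℝ := fun z => inner ℝ (n z) (f 0 z) with hb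
  have has : ContDiff ℝ ∞ a := hts.inner ℝ (hf 0)
  have hbs : ContDiff ℝ ∞ b := hns.inner ℝ (hf 0)
  have hrp : FlatPeriodic τ r := fun z w h => by simp only [hr, hρ, hpp z w h]
  have hap : FlatPeriodic τ a := fun z w h => by
    simp only [ha, ht, hpp z w h, hfp 0 z w h, hrp z w h]
  have hbp : FlatPeriodic τ b := fun z w h => by
    simp only [hb, hn, hqp z w h, hfp 0 z w h, hrp z w h]
  -- The given frame is tangent, so it expands in the orthonormal pair `t`, `n`.
  have hspan : ∀ k z, f k z = (inner ℝ (t z) (f k z) : ℝ) • t z + (inner ℝ (n z) (f k z) : ℝ) • n z := by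
    intro k z
    obtain ⟨v, hv⟩ := htan k z
    have h0 : r z ≠ 0 := inv_ne_zero (hsq z).ne'
    obtain ⟨x, y, hxy'⟩ : ∃ x y : ℝ, f k z = x • t z + y • n z := by
      refine ⟨v.re * (r z)⁻¹, v.im * (r z)⁻¹, ?_⟩
      have h1 : v = v.re • (1 : ℂ) + v.im • Complex.I := by
        apply Complex.ext <;> simp
      rw [hv]
      conv_lhs => rw [h1]
      simp only [ht, hn, smul_smul, mul_assoc, inv_mul_cancel₀ h0, mul_one, map_add, map_smul, hp, hq]
    have hnt : inner ℝ (n z) (t z) = (0 : ℝ) := by rw [real_inner_comm]; exact htn z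
    have h1 : inner ℝ (t z) (f k z) = x := by
      rw [hxy', inner_add_right, real_inner_smul_right (t z) (t z) x,
        real_inner_smul_right (t z) (n z) y, htt, htn]; ring
    have h2 : inner ℝ (n z) (f k z) = y := by
      rw [hxy', inner_add_right, real_inner_smul_right (n z) (t z) x,
        real_inner_smul_right (n z) (n z) y, hnt, hnn]; ring
    rw [h1, h2, hxy']
  have hnt : ∀ z, inner ℝ (n z) (t z) = (0 : ℝ) := fun z => by rw [real_inner_comm]; exact htn z
  have hinner : ∀ k l z, (inner ℝ (f k z) (f l z) : ℝ) = inner ℝ (t z) (f k z) * inner ℝ (t z) (f l z) +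
      inner ℝ (n z) (f k z) * inner ℝ (n z) (f l z) := by
    intro k l z
    conv_lhs => rw [hspan k z]
    rw [inner_add_left, real_inner_smul_left (t z) (f l z) _, real_inner_smul_left (n z) (f l z) _]
  have hab : ∀ z, a z ^ 2 + b z ^ 2 = 1 := by
    intro z
    have h1 := hinner 0 0 z
    rw [real_inner_self_eq_norm_sq, (hon z).1 0] at h1
    simp only [ha, hb]
    linarith
  have h₀ : ∀ z, f 0 z = a z • t z + b z • n z := fun z => hspan 0 z
  -- Orthonormality leaves two candidates for `f 1`; the orientation makes the change of frame a
  -- rotation.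
  have h₁ : ∀ z, f 1 z = -b z • t z + a z • n z := by
    intro z
    set c : ℝ := inner ℝ (t z) (f 1 z) with hc
    set d : ℝ := inner ℝ (n z) (f 1 z) with hd'
    have k1 : c ^ 2 + d ^ 2 = 1 := by
      have h1 := hinner 1 1 z
      rw [real_inner_self_eq_norm_sq, (hon z).1 1] at h1
      linarith
    have k2 : a z * c + b z * d = 0 := by
      rw [← hinner 0 1 z]; exact (hon z).2 (by decide)
    have k3 : 0 < a z * d - c * b z := by
      have e1 : ∀ k, (inner ℝ (t z) (f k z) : ℝ) = r z * inner ℝ (p z) (f k z) := fun k =>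
        real_inner_smul_left _ _ _
      have e2 : ∀ k, (inner ℝ (n z) (f k z) : ℝ) = r z * inner ℝ (q z) (f k z) := fun k =>
        real_inner_smul_left _ _ _
      simp only [hc, hd', ha, hb, e1, e2]
      have h0 : 0 < r z := inv_pos.2 (hsq z)
      have := mul_pos (mul_pos h0 h0) (hor z)
      linarith
    have k4 : a z * d - c * b z = 1 := by
      have : (a z * d - c * b z) ^ 2 = 1 := by
        linear_combination (c ^ 2 + d ^ 2) * hab z + k1 - (a z * c + b z * d) * k2
      nlinarith
    have hcb : c = -b z := by linear_combination (-b z) * k4 + a z * k2 - c * hab z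
    have hda : d = a z := by linear_combination a z * k4 + b z * k2 - d * hab z
    rw [hspan 1 z, ← hc, ← hd', hcb, hda]
  set l : ℂ → ℝ := fun z => 1 / 2 * Real.log (ρ z) with hl
  have hls : ContDiff ℝ ∞ l := contDiff_const.mul (hρs.log fun z => (hρ0 z).ne')
  have hlp : FlatPeriodic τ l := fun z w h => by simp only [hl, hρ, hpp z w h]
  have hpd := hps.differentiable (by simp)
  have hqd := hqs.differentiable (by simp)
  have hld : ∀ z v, fderiv ℝ l z v = inner ℝ (fderiv ℝ p z v) (p z) * (ρ z)⁻¹ := by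
    intro z v
    have h1 : HasFDerivAt l _ z :=
      ((hρs.differentiable (by simp) z).hasFDerivAt.log (hρ0 z).ne').const_mul (1 / 2)
    rw [h1.fderiv]
    simp only [_root_.smul_apply, smul_eq_mul, hρ]
    rw [fderiv_inner_apply ℝ (hpd z) (hpd z), real_inner_comm (fderiv ℝ p z v) (p z)]
    ring
  have hα : ∀ z v, (inner ℝ (fderiv ℝ t z v) (n z) : ℝ) =
      inner ℝ (fderiv ℝ p z v) (q z) * (ρ z)⁻¹ := by
    intro z v
    have h1 : HasFDerivAt t _ z :=
      (hrs.differentiable (by simp) z).hasFDerivAt.smul (hpd z).hasFDerivAt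
    rw [h1.fderiv]
    simp only [hn, _root_.add_apply, _root_.smul_apply, ContinuousLinearMap.smulRight_apply,
      inner_add_left, real_inner_smul_left, real_inner_smul_right]
    rw [hpq, ← eq_inv_of_mul_eq_one_left (hr2 z)]
    ring
  have hcomm : ∀ z, fderiv ℝ q z 1 = fderiv ℝ p z Complex.I := fun z => fderiv_fderiv_comm hφ z _ _
  -- Connection form of the coordinate frame: this component comes from differentiating `p · q = 0`,
  -- the next one from differentiating `q · q = p · p`, both using the symmetry of the second
  -- derivative of `φ`.
  have hαx : ∀ z, (inner ℝ (fderiv ℝ t z 1) (n z) : ℝ) = -fderiv ℝ l z Complex.I := by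
    intro z
    have h1 := inner_fderiv_add_of_const hpd hqd hpq z 1
    rw [hcomm, real_inner_comm] at h1
    rw [hα, hld, eq_neg_of_add_eq_zero_right h1]
    ring
  have hαy : ∀ z, (inner ℝ (fderiv ℝ t z Complex.I) (n z) : ℝ) = fderiv ℝ l z 1 := by
    intro z
    have h1 := fderiv_inner_apply ℝ (hpd z) (hpd z) 1
    have h2 := fderiv_inner_apply ℝ (hqd z) (hqd z) 1
    rw [(funext hqq : (fun z => (inner ℝ (q z) (q z) : ℝ)) = ρ), hcomm] at h2
    rw [← hρ, h2, real_inner_comm (fderiv ℝ p z 1) (p z),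
      real_inner_comm (fderiv ℝ p z Complex.I) (q z)] at h1
    rw [hα, hld]
    congr 1
    linarith
  have hdens : ∀ z, ∑ k, flatDensity (f k) z = flatDensity t z + flatDensity n z +
      4 * (-fderiv ℝ l z Complex.I * (a z * fderiv ℝ b z 1 - b z * fderiv ℝ a z 1) +
        fderiv ℝ l z 1 * (a z * fderiv ℝ b z Complex.I - b z * fderiv ℝ a z Complex.I)) +
      2 * ((a z * fderiv ℝ b z 1 - b z * fderiv ℝ a z 1) ^ 2 +
        (a z * fderiv ℝ b z Complex.I - b z * fderiv ℝ a z Complex.I) ^ 2) := by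
    intro z
    have key := flatDensity_frame_eq (hts.differentiable (by simp)) (hns.differentiable (by simp))
      (has.differentiable (by simp)) (hbs.differentiable (by simp)) htt hnn htn hab h₀ h₁ z
    have k1 := key 1
    have k2 := key Complex.I
    rw [hαx] at k1
    rw [hαy] at k2
    rw [Fin.sum_univ_two]
    simp only [flatDensity]
    linarith
  have hcross := integral_cross_term hls has hbs hlp hap hbp hab
  set X : ℂ → ℝ := fun z =>
      -fderiv ℝ l z Complex.I * (a z * fderiv ℝ b z 1 - b z * fderiv ℝ a z 1) +
      fderiv ℝ l z 1 * (a z * fderiv ℝ b z Complex.I - b z * fderiv ℝ a z Complex.I) with hX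
  have hXc : Continuous X := by
    have c1 := fun v => (hd hls v).continuous
    have c2 := fun v => (hd has v).continuous
    have c3 := fun v => (hd hbs v).continuous
    exact ((c1 _).neg.mul ((has.continuous.mul (c3 _)).sub (hbs.continuous.mul (c2 _)))).add
      ((c1 _).mul ((has.continuous.mul (c3 _)).sub (hbs.continuous.mul (c2 _))))
  have hA := (flatMap τ).continuous
  have htc : Continuous fun z => ‖fderiv ℝ t z 1‖ ^ 2 := (hd hts 1).continuous.norm.pow 2
  have hfc : ∀ k, Continuous (flatDensity (f k)) := fun k =>
    ((hd (hf k) 1).continuous.norm.pow 2).add ((hd (hf k) Complex.I).continuous.norm.pow 2)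
  -- The lines `s ↦ s + yτ` close up after unit time because `1` is a period, and `t` is the unit
  -- tangent of their images.
  have hloop : 1 ≤ ∫ s in Icc (0 : Plane) 1, ‖fderiv ℝ t (flatMap τ s) 1‖ ^ 2 := by
    refine one_le_setIntegral_of_lines (htc.comp hA) fun y => ?_
    have hline : ∀ s : ℝ, flatMap τ ![s, y] = s + y * τ := fun s => by simp [flatMap_apply]
    have hlined : ∀ s : ℝ, HasDerivAt (fun s : ℝ => (s + y * τ : ℂ)) 1 s := fun s =>
      Complex.ofRealCLM.hasDerivAt.add_const _
    simp only [hline]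
    refine one_le_integral_of_closed (γ := fun s : ℝ => φ (s + y * τ))
      (T := fun s : ℝ => t (s + y * τ)) (c := fun s : ℝ => Real.sqrt (ρ (s + y * τ)))
      (fun s => hsq _) (fun s => ?_) (fun s => ?_) ?_ (fun s => ?_) ?_
    · rw [← sq_eq_sq₀ (norm_nonneg _) zero_le_one, ← real_inner_self_eq_norm_sq, htt, one_pow]
    · exact ((hts.differentiable (by simp) _).hasFDerivAt.comp_hasDerivAt s (hlined s))
    · exact (hd hts 1).continuous.comp (by fun_prop)
    · have h1 := ((hφ.differentiable (by simp) _).hasFDerivAt.comp_hasDerivAt s (hlined s))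
      have h2 : Real.sqrt (ρ (s + y * τ)) • t (s + y * τ) = p (s + y * τ) := by
        change Real.sqrt (ρ (s + y * τ)) • r (s + y * τ) • p (s + y * τ) = _
        rw [smul_smul]
        change (Real.sqrt (ρ (s + y * τ)) * (Real.sqrt (ρ (s + y * τ)))⁻¹) • p (s + y * τ) = _
        rw [mul_inv_cancel₀ (hsq _).ne', one_smul]
      rw [h2]
      exact h1
    · exact hφp _ _ ⟨1, 0, by push_cast; ring⟩
  have hXi : IntegrableOn (fun s : Plane => 4 * X (flatMap τ s)) (Icc (0 : Plane) 1) :=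
    (continuous_const.mul (hXc.comp hA)).integrableOn_Icc
  have hti : IntegrableOn (fun s : Plane => ‖fderiv ℝ t (flatMap τ s) 1‖ ^ 2) (Icc (0 : Plane) 1) :=
    (htc.comp hA).integrableOn_Icc
  calc (1 : ℝ) ≤ ∫ s in Icc (0 : Plane) 1, ‖fderiv ℝ t (flatMap τ s) 1‖ ^ 2 := hloop
    _ = ∫ s in Icc (0 : Plane) 1, (‖fderiv ℝ t (flatMap τ s) 1‖ ^ 2 + 4 * X (flatMap τ s)) := by
      rw [integral_add hti hXi, integral_const_mul, hcross, mul_zero, add_zero]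
    _ ≤ _ := by
      refine setIntegral_mono (hti.add hXi)
        (continuous_finsetSum _ fun k _ => (hfc k).comp hA).integrableOn_Icc fun s => ?_
      change _ ≤ ∑ k, flatDensity (f k) (flatMap τ s)
      rw [hdens]
      simp only [hX, flatDensity]
      nlinarith [sq_nonneg ‖fderiv ℝ t (flatMap τ s) Complex.I‖,
        sq_nonneg ‖fderiv ℝ n (flatMap τ s) 1‖, sq_nonneg ‖fderiv ℝ n (flatMap τ s) Complex.I‖,
        sq_nonneg (a (flatMap τ s) * fderiv ℝ b (flatMap τ s) 1 -
          b (flatMap τ s) * fderiv ℝ a (flatMap τ s) 1),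
        sq_nonneg (a (flatMap τ s) * fderiv ℝ b (flatMap τ s) Complex.I -
          b (flatMap τ s) * fderiv ℝ a (flatMap τ s) Complex.I)]

end FrameEnergy

end

/-! ### Conformal class of an immersion, the height bound, and changes of lattice basis -/

noncomputable section

open MeasureTheory Set Topology

namespace FrameEnergy

lemma inner_fderiv_eq_dotProduct {m : ℕ} (Φ : Plane → E m) (x v w : Plane) :
    (inner ℝ (fderiv ℝ Φ x v) (fderiv ℝ Φ x w) : ℝ) = v ⬝ᵥ (inducedMetric Φ x).mulVec w := by
  rw [fderiv_eq_sum_pd, fderiv_eq_sum_pd]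
  simp only [inner_add_left, inner_add_right, real_inner_smul_left, real_inner_smul_right,
    inducedMetric, dotProduct, Matrix.mulVec, Fin.sum_univ_two, Matrix.of_apply]
  ring

/-- The metric induced by an immersion of the torus has a conformal class. -/
lemma IsTorusImmersion.exists_isConformalClass {m : ℕ} {Φ : Plane → E m}
    (h : IsTorusImmersion Φ) : ∃ p, IsConformalClass (inducedMetric Φ) p := by
  have hpd : ∀ i, ContDiff ℝ ∞ (pd i Φ) := fun i =>
    (h.smooth.fderiv_right (m := ∞) (by simp)).clm_apply contDiff_const
  have hpos : ∀ x (v : Plane), v ≠ 0 → 0 < v ⬝ᵥ (inducedMetric Φ x).mulVec v := by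
    intro x v hv
    rw [← inner_fderiv_eq_dotProduct, real_inner_self_eq_norm_sq]
    have : fderiv ℝ Φ x v ≠ 0 := fun h0 => hv (h.injective_fderiv x (by rw [h0, map_zero]))
    positivity
  have hsymm : ∀ x, inducedMetric Φ x 1 0 = inducedMetric Φ x 0 1 := fun x =>
    real_inner_comm (pd 0 Φ x) (pd 1 Φ x)
  have h0 : ∀ x, 0 < inducedMetric Φ x 0 0 := fun x => by
    have := hpos x ![1, 0] (fun h => by simpa using congrFun h 0)
    simpa [dotProduct, Matrix.mulVec, Fin.sum_univ_two] using this
  obtain ⟨τ, Ψ, hΨ⟩ := exists_conformalDiffeo (g := inducedMetric Φ)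
    (fun i j => (hpd i).inner ℝ (hpd j)) (torusPeriodic_inducedMetric h.periodic) hsymm h0
    (fun x => by
      -- The quadratic form takes the value `g₀₀ det g` at this vector.
      have := hpos x ![-inducedMetric Φ x 0 1, inducedMetric Φ x 0 0] (fun h => by
        have := congrFun h 1
        exact (h0 x).ne' (by simpa using this))
      simp only [dotProduct, Matrix.mulVec, Fin.sum_univ_two, Matrix.cons_val_zero,
        Matrix.cons_val_one, hsymm] at this
      rw [Matrix.det_fin_two, hsymm]
      refine pos_of_mul_pos_right (b := _) (a := inducedMetric Φ x 0 0) ?_ (h0 x).le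
      linarith)
  exact ⟨moduliMk τ, τ, rfl, Ψ, hΨ⟩

/-- Cramer's rule; it transfers tangency of the frame from `Φ` to `Φ ∘ Ψ`. -/
lemma exists_fderiv_eq_of_det_pos {Ψ : ℂ → Plane} {z : ℂ}
    (h : 0 < (Matrix.of ![fderiv ℝ Ψ z 1, fderiv ℝ Ψ z Complex.I]).det) (V : Plane) :
    ∃ v, fderiv ℝ Ψ z v = V := by
  rw [Matrix.det_fin_two] at h
  simp only [Matrix.of_apply, Matrix.cons_val_zero, Matrix.cons_val_one] at h
  set A := fderiv ℝ Ψ z 1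
  set B := fderiv ℝ Ψ z Complex.I
  refine ⟨((V 0 * B 1 - V 1 * B 0) / (A 0 * B 1 - A 1 * B 0)) • (1 : ℂ) +
    ((A 0 * V 1 - A 1 * V 0) / (A 0 * B 1 - A 1 * B 0)) • Complex.I, ?_⟩
  rw [map_add, map_smul, map_smul]
  have h0 := h.ne'
  funext i
  fin_cases i
  · change (V 0 * B 1 - V 1 * B 0) / (A 0 * B 1 - A 1 * B 0) * A 0 +
      (A 0 * V 1 - A 1 * V 0) / (A 0 * B 1 - A 1 * B 0) * B 0 = V 0
    rw [div_mul_eq_mul_div, div_mul_eq_mul_div, ← add_div, div_eq_iff h0]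
    ring
  · change (V 0 * B 1 - V 1 * B 0) / (A 0 * B 1 - A 1 * B 0) * A 1 +
      (A 0 * V 1 - A 1 * V 0) / (A 0 * B 1 - A 1 * B 0) * B 1 = V 1
    rw [div_mul_eq_mul_div, div_mul_eq_mul_div, ← add_div, div_eq_iff h0]
    ring

/-- The height of a conformal parameter is bounded by the frame energy. -/
lemma im_le_frameEnergy {m : ℕ} {Φ : Plane → E m} {e : Fin 2 → Plane → E m} {τ : ℍ}
    {Ψ : ℂ → Plane} (hΦ : IsTorusImmersion Φ) (he : IsMovingFrame Φ e)
    (h : IsConformalDiffeo τ (inducedMetric Φ) Ψ) : τ.im ≤ 4 * frameEnergy Φ e := by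
  have hfd : ∀ z v, fderiv ℝ (fun z => Φ (Ψ z)) z v = fderiv ℝ Φ (Ψ z) (fderiv ℝ Ψ z v) := by
    intro z v
    have := (hΦ.smooth.differentiable (by simp) (Ψ z)).hasFDerivAt.comp z
      (h.smooth.differentiable (by simp) z).hasFDerivAt
    exact congrArg (fun L : ℂ →L[ℝ] E m => L v) this.fderiv
  have hinner : ∀ z, ∃ ρ : ℝ, 0 < ρ ∧ ∀ v w, (inner ℝ (fderiv ℝ (fun z => Φ (Ψ z)) z v)
      (fderiv ℝ (fun z => Φ (Ψ z)) z w) : ℝ) = ρ * inner ℝ v w := by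
    intro z
    obtain ⟨ρ, hρ, hc⟩ := h.conformal z
    exact ⟨ρ, hρ, fun v w => by rw [hfd, hfd, inner_fderiv_eq_dotProduct, hc]⟩
  have key : 1 ≤ ∫ s in Icc (0 : Plane) 1,
      ∑ k, flatDensity (fun z => e k (Ψ z)) (flatMap τ s) := by
    refine one_le_integral_flatDensity (φ := fun z => Φ (Ψ z)) (f := fun k z => e k (Ψ z))
      (hΦ.smooth.comp h.smooth) (fun z w hzw => hΦ.periodic _ _ ((h.descends z w).1 hzw))
      (fun k => (he.smooth k).smooth.comp h.smooth)
      (fun k z w hzw => (he.smooth k).periodic _ _ ((h.descends z w).1 hzw))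
      (fun z => ?_) (fun z => ?_) (fun z => ?_) (fun z => he.orthonormal _) (fun k z => ?_)
      (fun z => ?_)
    · obtain ⟨ρ, hρ, hc⟩ := hinner z
      rw [hc]
      simpa using hρ
    · obtain ⟨ρ, hρ, hc⟩ := hinner z
      rw [hc]
      simp [Complex.inner]
    · obtain ⟨ρ, hρ, hc⟩ := hinner z
      rw [hc, hc]
      simp
    · obtain ⟨V, hV⟩ := he.tangent k (Ψ z)
      obtain ⟨v, hv⟩ := exists_fderiv_eq_of_det_pos (h.orientation z) V
      exact ⟨v, by rw [hfd, hv]; exact hV.symm⟩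
    · have h1 := he.positive (Ψ z)
      have h2 := h.orientation z
      -- Orientation of the frame relative to the flat coordinates: the two determinants multiply.
      have := mul_pos h2 h1
      rw [Matrix.det_fin_two, Matrix.det_fin_two] at this
      simp only [Matrix.of_apply, Matrix.cons_val_zero, Matrix.cons_val_one] at this
      simp only [hfd, fderiv_eq_sum_pd Φ (Ψ z), inner_add_left, real_inner_smul_left]
      linarith
  rw [frameEnergy_eq hΦ.periodic he.smooth h]
  nlinarith [mul_le_mul_of_nonneg_left key τ.im_pos.le]

/-- A change of basis of the lattice transforms conformal parametrizations. -/
lemma IsConformalDiffeo.smul {τ : ℍ} {g : Plane → Matrix (Fin 2) (Fin 2) ℝ} {Ψ : ℂ → Plane}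
    (h : IsConformalDiffeo τ g Ψ) (γ : SL(2, ℤ)) :
    ∃ Ψ' : ℂ → Plane, IsConformalDiffeo (γ • τ) g Ψ' := by
  have hdet : (γ 0 0 * γ 1 1 - γ 0 1 * γ 1 0 : ℤ) = 1 := by
    rw [← Matrix.det_fin_two]; exact γ.det_coe
  have hdetC : (γ 0 0 * γ 1 1 - γ 0 1 * γ 1 0 : ℂ) = 1 := by exact_mod_cast hdet
  -- Multiplication by the automorphy factor `d` carries `ℤ + (γ•τ)ℤ` onto `ℤ + τℤ`, since `d (γ•τ)
  -- = γ₀₀ τ + γ₀₁` and `det γ = 1`.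
  set d : ℂ := γ 1 0 * τ + γ 1 1 with hd
  have hd0 : d ≠ 0 := by
    intro h0
    have him := congrArg Complex.im h0
    have hre := congrArg Complex.re h0
    simp [hd] at him hre
    have hτ := τ.im_pos.ne'
    rcases him with h1 | h1
    · have h1' : γ 1 0 = 0 := by exact_mod_cast h1
      rw [h1] at hre
      have h2 : γ 1 1 = 0 := by
        have : (γ 1 1 : ℝ) = 0 := by simpa using hre
        exact_mod_cast this
      rw [h1', h2] at hdet
      simp at hdet
    · exact hτ h1
  have hsmul : d * ((γ • τ : ℍ) : ℂ) = γ 0 0 * τ + γ 0 1 := by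
    rw [UpperHalfPlane.coe_specialLinearGroup_apply]
    simp only [algebraMap_int_eq, eq_intCast, Complex.ofReal_intCast]
    rw [← hd]
    field_simp
  have hflat : ∀ z w, SameFlatPoint (γ • τ) z w ↔ SameFlatPoint τ (d * z) (d * w) := by
    intro z w
    constructor
    · rintro ⟨a, b, hab⟩
      refine ⟨a * γ 1 1 + b * γ 0 1, a * γ 1 0 + b * γ 0 0, ?_⟩
      push_cast
      rw [← mul_sub, hab]
      linear_combination (b : ℂ) * hsmul + a * hd
    · rintro ⟨a, b, hab⟩
      refine ⟨a * γ 0 0 - b * γ 0 1, b * γ 1 1 - a * γ 1 0, ?_⟩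
      apply mul_left_cancel₀ hd0
      push_cast
      rw [mul_sub, hab]
      linear_combination -((b : ℂ) * γ 1 1 - a * γ 1 0) * hsmul -
        ((a : ℂ) * γ 0 0 - b * γ 0 1) * hd - (a + b * (τ : ℂ)) * hdetC
  have hfd : ∀ z v, fderiv ℝ (fun z => Ψ (d * z)) z v = fderiv ℝ Ψ (d * z) (d * v) := by
    intro z v
    have h1 : HasFDerivAt (fun z : ℂ => d * z) (ContinuousLinearMap.mul ℝ ℂ d) z :=
      (ContinuousLinearMap.mul ℝ ℂ d).hasFDerivAt
    have := (h.smooth.differentiable (by simp) (d * z)).hasFDerivAt.comp z h1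
    exact congrArg (fun L : ℂ →L[ℝ] Plane => L v) this.fderiv
  have hns : 0 < Complex.normSq d := Complex.normSq_pos.2 hd0
  refine ⟨fun z => Ψ (d * z), h.smooth.comp (contDiff_const.mul contDiff_id),
    fun z w => (hflat z w).trans (h.descends _ _), fun y => ?_, fun z => ?_, fun z => ?_⟩
  · obtain ⟨z, hz⟩ := h.surjective y
    exact ⟨d⁻¹ * z, by simp only [mul_inv_cancel_left₀ hd0, hz]⟩
  · obtain ⟨ρ, hρ, hc⟩ := h.conformal (d * z)
    refine ⟨ρ * Complex.normSq d, mul_pos hρ hns, fun v w => ?_⟩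
    rw [hfd, hfd, hc]
    simp only [Complex.inner, Complex.normSq_apply, map_mul, Complex.mul_re, Complex.mul_im,
      Complex.conj_re, Complex.conj_im]
    ring
  · have e1 : fderiv ℝ (fun z => Ψ (d * z)) z 1 =
        d.re • fderiv ℝ Ψ (d * z) 1 + d.im • fderiv ℝ Ψ (d * z) Complex.I := by
      rw [hfd, ← map_smul, ← map_smul, ← map_add]
      congr 1
      apply Complex.ext <;> simp
    have e2 : fderiv ℝ (fun z => Ψ (d * z)) z Complex.I =
        -d.im • fderiv ℝ Ψ (d * z) 1 + d.re • fderiv ℝ Ψ (d * z) Complex.I := by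
      rw [hfd, ← map_smul, ← map_smul, ← map_add]
      congr 1
      apply Complex.ext <;> simp
    have := mul_pos hns (h.orientation (d * z))
    rw [e1, e2]
    rw [Matrix.det_fin_two] at this ⊢
    simp only [Matrix.of_apply, Matrix.cons_val_zero, Matrix.cons_val_one, Pi.add_apply,
      Pi.smul_apply, smul_eq_mul, Complex.normSq_apply] at this ⊢
    linarith

end FrameEnergy

end

theorem proposition1p1 (C : ℝ) (hC : 0 < C) :
    ∃ K : Set FrameEnergy.ModuliSpace, IsCompact K ∧
      ∀ (m : ℕ), 3 ≤ m →
        ∀ (Φ : FrameEnergy.Plane → FrameEnergy.E m)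
          (e : Fin 2 → FrameEnergy.Plane → FrameEnergy.E m),
          FrameEnergy.IsTorusImmersion Φ → FrameEnergy.IsMovingFrame Φ e →
          FrameEnergy.frameEnergy Φ e ≤ C →
            (∃ p, FrameEnergy.IsConformalClass (FrameEnergy.inducedMetric Φ) p) ∧
            ∀ p, FrameEnergy.IsConformalClass (FrameEnergy.inducedMetric Φ) p → p ∈ K := by
  -- The truncation height `4C` is the bound on `Im τ`. It holds for every conformal
  -- parametrization, so it may be applied after moving `τ` into the fundamental domain.
  refine ⟨FrameEnergy.moduliMk '' ModularGroup.truncatedFundamentalDomain (4 * C),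
    (ModularGroup.isCompact_truncatedFundamentalDomain _).image continuous_quotient_mk', ?_⟩
  intro m _ Φ e hΦ he hF
  refine ⟨hΦ.exists_isConformalClass, ?_⟩
  rintro p ⟨τ, rfl, Ψ, hΨ⟩
  obtain ⟨γ, hγ⟩ := ModularGroup.exists_smul_mem_fd τ
  obtain ⟨Ψ', hΨ'⟩ := hΨ.smul γ
  refine ⟨γ • τ, ⟨hγ, ?_⟩, Quotient.sound ⟨γ, rfl⟩⟩
  have := FrameEnergy.im_le_frameEnergy hΦ he hΨ'
  linarith
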